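/- Let $\Phi$ be a reduced crystallographic root system in a finite-dimensional real vector space $V$, with Weyl group $W$, simple roots $\alpha_1,\dots,\alpha_n$, positive roots $\Phi^+$, fundamental weights $\omega_1,\dots,\omega_n$ (so $\langle\omega_i,\alpha_j^\vee\rangle=\delta_{ij}$) and weight lattice $P=\{v\in V:\langle v,\alpha^\vee\rangle\in\mathbb Z\text{ for all }\alpha\in\Phi\}$. Assume that $\Phi$ is simply laced, i.e. its Dynkin diagram $D$ (on the vertex set $[n]=\{1,\dots,n\}$) has only single undirected edges: $\langle\alpha_i,\alpha_j^\vee\rangle\in\{0,-1\}$ for $i\neq j$, with $i,j$ adjacent if and only if the value is $-1$. ($\Phi$ need not be irreducible.) *Unlabeled central-firing.* For $\lambda\in P$ write $\lambda\to\lambda+\alpha$ whenever $\alpha\in\Phi^+$ and $\langle\lambda,\alpha^\vee\rangle=0$. On $W$-orbits write $W\lambda\to W\mu$ if $\lambda'\to\mu'$ for some $\lambda'\in W\lambda$, $\mu'\in W\mu$. *UCF moves.* Let $f:[n]\to\mathbb Z_{\ge0}$. A zero connected component of $f$ is a connected component $R$ of the subgraph of $D$ induced on $\{i: f(i)=0\}$.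 A UCF move along $R$ replaces $f$ by the assignment $f'$ obtained as follows: complete $R$ to its affine Dynkin diagram $\widetilde R$ (one of $\widetilde A_m,\widetilde D_m,\widetilde E_6,\widetilde E_7,\widetilde E_8$), with vertex set $R\cup\{0\}$ and affine node $0$; for every edge $\{0,i\}$ of $\widetilde R$, counted with multiplicity, increase $f(i)$ by $1$; for every vertex $j\notin R$ adjacent in $D$ to a vertex of $R$, decrease $f(j)$ by $1$. Put $\lambda(f)=\sum_{i=1}^n f(i)\,\omega_i$. Then: (0) UCF moves are well defined: for every $f:[n]\to\mathbb Z_{\ge0}$ and every zero connected component $R$ of $f$ there is exactly one $f':[n]\to\mathbb Z_{\ge0}$ obtained from $f$ by a UCF move along $R$. (i) For all $f,f':[n]\to\mathbb Z_{\ge0}$, the assignment $f'$ is obtained from $f$ by a UCF move if and only if $W\lambda(f)\to W\lambda(f')$. (ii) UCF moves commute: let $R_1\neq R_2$ be zero connected components of $f$, and let $f_1'$ (resp. $f_2'$) be obtained from $f$ by a UCF move along $R_1$ (resp. $R_2$). Then $f_1'$ has a zero connected component $R_2'\supseteq R_2$, $f_2'$ has a zero connected component $R_1'\supseteq R_1$,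 and the UCF move applied to $f_1'$ along $R_2'$ gives the same result as the UCF move applied to $f_2'$ along $R_1'$. -/

import Mathlib

noncomputable section

/-! ### The number game on a graph -/

/-- `A` is the adjacency matrix (entry `A v w` = number of edges between `v` and `w`) of a simply
laced affine Dynkin diagram, and `o` is its affine node. The affine Dynkin diagrams are
the diagrams of the indecomposable generalized Cartan matrices `2 - A` of affine type, i.e. the
connected ones for which there is a vector `δ` of positive integers with `(2 - A) δ = 0`; the affine
node is a node at which the primitive such `δ` equals `1`. Hence the list is `Ã₁` (two nodes joined
by two edges), `Ãₙ` (a cycle), `D̃ₙ`, `Ẽ₆`, `Ẽ₇`, `Ẽ₈`, and in each of these diagrams all the nodes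
with `δ = 1` are equivalent to the usual affine node under a diagram automorphism. -/
structure IsAffineDynkin {X : Type*} [Fintype X] (A : Matrix X X ℕ) (o : X) : Prop where
  symm : ∀ v w, A v w = A w v
  loopless : ∀ v, A v v = 0
  connected : (SimpleGraph.fromRel fun v w => A v w ≠ 0).Connected
  marks : ∃ δ : X → ℕ, (∀ v, 0 < δ v) ∧ (∀ v, ∑ w, A v w * δ w = 2 * δ v) ∧ δ o = 1

/-- `A` is the adjacency matrix of an affine Dynkin diagram with vertex set `R ∪ {0}` (the affine
node `0` is `none`) in which the subdiagram on `R` is the subgraph of `G` induced on `R`. -/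
structure IsAffineCompletion {X : Type*} (G : SimpleGraph X) (R : Finset X)
    (A : Matrix (Option R) (Option R) ℕ) : Prop where
  adj : ∀ i j : R, G.Adj i j → A (some i) (some j) = 1
  not_adj : ∀ i j : R, ¬ G.Adj i j → A (some i) (some j) = 0
  affine : IsAffineDynkin A none

/-- `R` is a zero connected component of `f`: a connected component of the subgraph of `G` induced
on `{i | f i = 0}`. -/
def IsZeroComponent {X : Type*} (G : SimpleGraph X) (f : X → ℕ) (R : Finset X) : Prop :=
  ∃ C : (G.induce {i | f i = 0}).ConnectedComponent, (R : Set X) = Subtype.val '' C.supp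

open Classical in
/-- `f'` is obtained from `f` via a UCF move along the zero connected component `R`: complete `R` to
an affine Dynkin diagram, increase `f i` by `1` for every edge `{0, i}` of it, and decrease `f j`
by `1` for every `j ∉ R` that is adjacent to a vertex of `R`. -/
def UCFMoveAlong {X : Type*} (G : SimpleGraph X) (f : X → ℕ) (R : Finset X) (f' : X → ℕ) : Prop :=
  IsZeroComponent G f R ∧
  ∃ A : Matrix (Option R) (Option R) ℕ, IsAffineCompletion G R A ∧
    ∀ j, (f' j : ℤ) = (f j : ℤ)
      + (if h : j ∈ R then (A none (some ⟨j, h⟩) : ℤ) else 0)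
      - (if j ∉ R ∧ ∃ i ∈ R, G.Adj i j then 1 else 0)

/-- `f'` is obtained from `f` by a UCF move. -/
def UCFMove {X : Type*} (G : SimpleGraph X) (f f' : X → ℕ) : Prop :=
  ∃ R : Finset X, UCFMoveAlong G f R f'

/-! ### Root systems -/

namespace RootPairing

variable {ι V N : Type*} [AddCommGroup V] [Module ℝ V] [AddCommGroup N] [Module ℝ N]

/-- The weight lattice: all `v` with `⟨v, α^∨⟩ ∈ ℤ` for every root `α`. -/
def weightLattice (P : RootPairing ι ℝ V N) : Set V :=
  {v | ∀ i, ∃ z : ℤ, P.toLinearMap v (P.coroot i) = z}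

namespace Base

variable {P : RootPairing ι ℝ V N} (b : P.Base)

/-- The underlying graph of the Dynkin diagram, on the set of simple roots: distinct `i`, `j` are
joined if `⟨αᵢ, αⱼ^∨⟩ ≠ 0`. If the Cartan matrix is simply laced, then every edge is a single
undirected one and this graph is the Dynkin diagram. -/
def dynkinGraph [P.IsCrystallographic] : SimpleGraph b.support :=
  SimpleGraph.fromRel fun i j => b.cartanMatrix i j ≠ 0

/-- Central-firing on the weight lattice: `v → v + α` for a positive root `α` orthogonal to `v`. -/
def CentralFires (v v' : V) : Prop :=
  v ∈ P.weightLattice ∧ ∃ i, b.IsPos i ∧ P.toLinearMap v (P.coroot i) = 0 ∧ v' = v + P.root i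

/-- Unlabeled central-firing: the relation induced by central-firing on Weyl group orbits. -/
def UnlabeledCentralFires (O O' : Set V) : Prop :=
  ∃ v ∈ O, ∃ v' ∈ O', b.CentralFires v v'

variable [P.IsRootSystem]

/-- The fundamental weights, i.e. the basis dual to the simple coroots. -/
def fundamentalWeight (i : b.support) : V :=
  P.toLinearMap.toPerfPair.symm (b.toCoweightBasis.coord i)

theorem fundamentalWeight_coroot [DecidableEq b.support] (i j : b.support) :
    P.toLinearMap (b.fundamentalWeight i) (P.coroot j) = if i = j then 1 else 0 := by
  have h : P.toLinearMap (b.fundamentalWeight i) = b.toCoweightBasis.coord i := by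
    exact P.toLinearMap.toPerfPair.apply_symm_apply (b.toCoweightBasis.coord i)
  rw [h, ← b.toCoweightBasis_apply j]
  simp [Finsupp.single_apply, eq_comm]

/-- The dominant weight `λ(f) = ∑ f(i) ωᵢ`. -/
def weightOf (f : b.support → ℕ) : V := ∑ i, f i • b.fundamentalWeight i

end Base

end RootPairing

end

/-! Everything is computed in the root lattice: roots become the integer vectors `x` with `x ⬝ᵥ C *ᵥ
x = 2`, where `C` is the Cartan matrix, an even positive definite form. A weight is its vector of
values on simple coroots, so adding the root `x` adds `C *ᵥ x`, and simple lacing lets a root and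
its coroot share coordinates.

The central fact (`ucfMoveAlong_iff`) is that a UCF move along `R` adds the highest root `θ` of `R`.
The marks of an affine completion, restricted to `R`, form a root dominant on `R`, hence `θ`; so the
affine node has `⟨θ, αⱼ^∨⟩` edges to `j ∈ R`, while `⟨θ, αⱼ^∨⟩ = -1` at each outer neighbour `j` of
`R`. The result is again dominant because the outer neighbours of a zero component have positive
weight.

For (i), a root orthogonal to a dominant weight has connected support inside the zeros, hence inside
one zero component `R`. The parabolic subgroup of `R` fixes the weight and carries the root to `θ`.
Since an orbit contains only one dominant weight (`eq_of_dominant`), the orbit reached is that of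
the UCF move.

For (ii), one must show `θ₁ + θ₂' = θ₂ + θ₁'`. The vector `θ₂' - θ₂ + θ₁` turns out to be a root
supported in `R₁'`, hence at most `θ₁'`; exchanging the indices gives the opposite inequality. -/

open scoped Matrix

/-- `C` is the Cartan matrix of the simply laced graph `G`, and it is of finite type. -/
structure IsSimplyLacedCartan {X : Type*} [Fintype X] (G : SimpleGraph X) (C : Matrix X X ℤ) :
    Prop where
  diag : ∀ i, C i i = 2
  adj : ∀ i j, G.Adj i j → C i j = -1
  not_adj : ∀ i j, i ≠ j → ¬ G.Adj i j → C i j = 0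
  pos : ∀ x, x ≠ 0 → 0 < x ⬝ᵥ C *ᵥ x

/-- `θ` is the highest root of the root subsystem spanned by the simple roots in `R`. -/
structure IsHighestRoot {X : Type*} [Fintype X] (C : Matrix X X ℤ) (R : Finset X) (θ : X → ℤ) :
    Prop where
  root : θ ⬝ᵥ C *ᵥ θ = 2
  eq_zero : ∀ i, i ∉ R → θ i = 0
  pos : ∀ i ∈ R, 0 < θ i
  dominant : ∀ i ∈ R, 0 ≤ (C *ᵥ θ) i

/-- `R` is nonempty, and a subset of `R` closed under taking neighbours in `R` is empty or all
of `R`. -/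
structure IsConnectedFinset {X : Type*} (G : SimpleGraph X) (R : Finset X) : Prop where
  nonempty : R.Nonempty
  induction : ∀ p : X → Prop, (∀ i ∈ R, ∀ j ∈ R, G.Adj i j → p i → p j) →
    ∀ i ∈ R, p i → ∀ j ∈ R, p j

/-! ### Zero components as connected sets -/

section ZeroComponent

variable {X : Type*} {G : SimpleGraph X} {f : X → ℕ} {R : Finset X}

theorem IsZeroComponent.isConnectedFinset (h : IsZeroComponent G f R) : IsConnectedFinset G R := by
  obtain ⟨K, hK⟩ := h
  have hmem : ∀ i, i ∈ R ↔ ∃ a ∈ K.supp, (a : X) = i := fun i ↦ by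
    rw [← Finset.mem_coe, hK]; rfl
  refine ⟨?_, fun p hp i hi hpi j hj ↦ ?_⟩
  · obtain ⟨a, ha⟩ := K.nonempty_supp
    exact ⟨a, (hmem _).2 ⟨a, ha, rfl⟩⟩
  · obtain ⟨a, ha, rfl⟩ := (hmem i).1 hi
    obtain ⟨b, hb, rfl⟩ := (hmem j).1 hj
    have hr : (G.induce {i | f i = 0}).Reachable a b :=
      SimpleGraph.ConnectedComponent.exact (ha.trans hb.symm)
    obtain ⟨w⟩ := hr
    clear hb hj
    induction w with
    | nil => exact hpi
    | @cons u v w huv _ ih =>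
      have hv : v ∈ K.supp := by
        have : (G.induce {i | f i = 0}).connectedComponentMk v = K := by
          rw [← ha]; exact SimpleGraph.ConnectedComponent.sound huv.symm.reachable
        exact this
      have hvR := (hmem _).2 ⟨v, hv, rfl⟩
      exact ih hv hvR (hp u hi v hvR huv hpi)

theorem IsZeroComponent.eq_zero (h : IsZeroComponent G f R) {i : X} (hi : i ∈ R) : f i = 0 := by
  obtain ⟨K, hK⟩ := h
  rw [← Finset.mem_coe, hK] at hi
  obtain ⟨a, -, rfl⟩ := hi
  exact a.2

theorem IsZeroComponent.mem_of_adj (h : IsZeroComponent G f R) {i j : X} (hi : i ∈ R)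
    (hij : G.Adj i j) (hj : f j = 0) : j ∈ R := by
  obtain ⟨K, hK⟩ := h
  rw [← Finset.mem_coe, hK] at hi ⊢
  obtain ⟨a, ha, rfl⟩ := hi
  refine ⟨⟨j, hj⟩, ?_, rfl⟩
  have hadj : (G.induce {i | f i = 0}).Adj a ⟨j, hj⟩ := hij
  have : (G.induce {i | f i = 0}).connectedComponentMk ⟨j, hj⟩ = K := by
    rw [← ha]; exact SimpleGraph.ConnectedComponent.sound hadj.symm.reachable
  exact this

theorem exists_isZeroComponent [Finite X] {i : X} (hi : f i = 0) :
    ∃ R : Finset X, IsZeroComponent G f R ∧ i ∈ R := by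
  classical
  have := Fintype.ofFinite X
  let K := (G.induce {i | f i = 0}).connectedComponentMk ⟨i, hi⟩
  refine ⟨(Subtype.val '' K.supp).toFinset, ⟨K, by simp⟩, ?_⟩
  rw [Set.mem_toFinset]
  exact ⟨⟨i, hi⟩, rfl, rfl⟩

/-- A connected set of zeros that meets a zero component lies in it. -/
theorem IsZeroComponent.subset_of_connected {S : Finset X} (h : IsZeroComponent G f R)
    (hS : IsConnectedFinset G S) (hz : ∀ i ∈ S, f i = 0) {i : X} (hi : i ∈ S) (hiR : i ∈ R) :
    S ⊆ R :=
  fun j hj ↦ hS.induction (· ∈ R) (fun _ _ k hk hlk hl ↦ h.mem_of_adj hl hlk (hz k hk)) i hi hiR j hj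

theorem IsZeroComponent.eq_of_mem {S : Finset X} (h : IsZeroComponent G f R)
    (hS : IsZeroComponent G f S) {i : X} (hi : i ∈ S) (hiR : i ∈ R) : R = S :=
  (hS.subset_of_connected h.isConnectedFinset (fun _ ↦ h.eq_zero) hiR hi).antisymm
    (h.subset_of_connected hS.isConnectedFinset (fun _ ↦ hS.eq_zero) hi hiR)

end ZeroComponent

/-! ### Roots as norm 2 vectors of an even positive definite form -/

namespace IsSimplyLacedCartan

variable {X : Type*} [Fintype X] {G : SimpleGraph X} {C : Matrix X X ℤ} {R : Finset X}
  {x y : X → ℤ} {i j : X}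

theorem apply_comm (h : IsSimplyLacedCartan G C) (i j : X) : C i j = C j i := by
  rcases eq_or_ne i j with rfl | hij
  · rfl
  by_cases ha : G.Adj i j
  · rw [h.adj i j ha, h.adj j i ha.symm]
  · rw [h.not_adj i j hij ha, h.not_adj j i hij.symm fun h ↦ ha h.symm]

theorem form_comm (h : IsSimplyLacedCartan G C) (x y : X → ℤ) :
    x ⬝ᵥ C *ᵥ y = y ⬝ᵥ C *ᵥ x := by
  have : Cᵀ = C := by ext i j; exact h.apply_comm j i
  rw [Matrix.dotProduct_mulVec, ← Matrix.mulVec_transpose, this, dotProduct_comm]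

theorem form_single [DecidableEq X] (x : X → ℤ) (j : X) :
    Pi.single j 1 ⬝ᵥ C *ᵥ x = (C *ᵥ x) j := by simp

theorem single_root [DecidableEq X] (h : IsSimplyLacedCartan G C) (j : X) :
    Pi.single j 1 ⬝ᵥ C *ᵥ Pi.single j 1 = (2 : ℤ) := by
  simp [h.diag]

theorem form_add_self (h : IsSimplyLacedCartan G C) (x y : X → ℤ) :
    (x + y) ⬝ᵥ C *ᵥ (x + y) = x ⬝ᵥ C *ᵥ x + 2 * (x ⬝ᵥ C *ᵥ y) + y ⬝ᵥ C *ᵥ y := by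
  simp only [Matrix.mulVec_add, dotProduct_add, add_dotProduct]
  rw [h.form_comm y x]
  ring

theorem form_sub_self (h : IsSimplyLacedCartan G C) (x y : X → ℤ) :
    (x - y) ⬝ᵥ C *ᵥ (x - y) = x ⬝ᵥ C *ᵥ x - 2 * (x ⬝ᵥ C *ᵥ y) + y ⬝ᵥ C *ᵥ y := by
  simp only [Matrix.mulVec_sub, dotProduct_sub, sub_dotProduct]
  rw [h.form_comm y x]
  ring

theorem even_form (h : IsSimplyLacedCartan G C) (x : X → ℤ) : Even (x ⬝ᵥ C *ᵥ x) := by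
  classical
  have hx : x = ∑ i, Pi.single i (x i) := (Finset.univ_sum_single x).symm
  rw [hx]
  refine Finset.sum_induction _ (fun x : X → ℤ ↦ Even (x ⬝ᵥ C *ᵥ x)) (fun a b ha hb ↦ ?_)
    (by simp) fun i _ ↦ ?_
  · rw [h.form_add_self]
    exact (ha.add (even_two_mul _)).add hb
  · rw [Matrix.mulVec_single, single_dotProduct]
    exact ⟨x i * x i, by simp [h.diag]; ring⟩

theorem two_le_form (h : IsSimplyLacedCartan G C) (hx : x ≠ 0) : 2 ≤ x ⬝ᵥ C *ᵥ x := by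
  have h₁ := h.pos x hx
  obtain ⟨k, hk⟩ := h.even_form x
  omega

theorem apply_nonpos (h : IsSimplyLacedCartan G C) (hij : i ≠ j) : C i j ≤ 0 := by
  by_cases ha : G.Adj i j
  · simp [h.adj i j ha]
  · simp [h.not_adj i j hij ha]

theorem form_nonpos_of_disjoint (h : IsSimplyLacedCartan G C) (hx : 0 ≤ x) (hy : 0 ≤ y)
    (hxy : ∀ i, x i = 0 ∨ y i = 0) : x ⬝ᵥ C *ᵥ y ≤ 0 := by
  simp only [dotProduct, Matrix.mulVec, Finset.mul_sum]
  refine Finset.sum_nonpos fun i _ ↦ Finset.sum_nonpos fun j _ ↦ ?_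
  rcases eq_or_ne i j with rfl | hij
  · rcases hxy i with h | h <;> simp [h]
  · exact mul_nonpos_of_nonneg_of_nonpos (hx i)
      (mul_nonpos_of_nonpos_of_nonneg (h.apply_nonpos hij) (hy j))

theorem form_eq_zero_of_not_adj (h : IsSimplyLacedCartan G C)
    (hxy : ∀ i j, x i ≠ 0 → y j ≠ 0 → i ≠ j ∧ ¬ G.Adj i j) : x ⬝ᵥ C *ᵥ y = 0 := by
  simp only [dotProduct, Matrix.mulVec, Finset.mul_sum]
  refine Finset.sum_eq_zero fun i _ ↦ Finset.sum_eq_zero fun j _ ↦ ?_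
  by_cases hi : x i = 0
  · simp [hi]
  by_cases hj : y j = 0
  · simp [hj]
  · obtain ⟨h₁, h₂⟩ := hxy i j hi hj
    simp [h.not_adj i j h₁ h₂]

/-- The positive and negative parts have disjoint supports, so they pair nonpositively; were both
nonzero, the norm of their difference would be at least `2 + 2`. -/
theorem nonneg_or_nonpos (h : IsSimplyLacedCartan G C) (hx : x ⬝ᵥ C *ᵥ x = 2) :
    0 ≤ x ∨ x ≤ 0 := by
  have hsub : x = x⁺ - x⁻ := (posPart_sub_negPart x).symm
  have hdis : x⁺ ⬝ᵥ C *ᵥ x⁻ ≤ 0 := by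
    refine h.form_nonpos_of_disjoint (posPart_nonneg x) (negPart_nonneg x) fun i ↦ ?_
    rw [Pi.posPart_apply, Pi.negPart_apply]
    rcases le_total (x i) 0 with hi | hi
    · exact Or.inl (posPart_eq_zero.2 hi)
    · exact Or.inr (negPart_eq_zero.2 hi)
  have hsum := h.form_sub_self x⁺ x⁻
  rw [← hsub, hx] at hsum
  by_cases h₁ : x⁺ = 0
  · exact Or.inr (posPart_eq_zero.1 h₁)
  by_cases h₂ : x⁻ = 0
  · exact Or.inl (negPart_eq_zero.1 h₂)
  have := h.two_le_form h₁
  have := h.two_le_form h₂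
  omega

theorem form_le_one (h : IsSimplyLacedCartan G C) (hx : x ⬝ᵥ C *ᵥ x = 2) (hy : y ⬝ᵥ C *ᵥ y = 2)
    (hxy : x ≠ y) : x ⬝ᵥ C *ᵥ y ≤ 1 := by
  have h₁ := h.pos (x - y) (sub_ne_zero.2 hxy)
  rw [h.form_sub_self] at h₁
  omega

theorem neg_one_le_form (h : IsSimplyLacedCartan G C) (hx : x ⬝ᵥ C *ᵥ x = 2)
    (hy : y ⬝ᵥ C *ᵥ y = 2) (hxy : x + y ≠ 0) : -1 ≤ x ⬝ᵥ C *ᵥ y := by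
  have h₁ := h.pos (x + y) hxy
  rw [h.form_add_self] at h₁
  omega

/-- Pairings with simple roots lie in `[-2, 2]`, and they determine the vector because the form is
nondegenerate. -/
theorem finite_roots (h : IsSimplyLacedCartan G C) : {x : X → ℤ | x ⬝ᵥ C *ᵥ x = 2}.Finite := by
  classical
  have hinj : Function.Injective fun x : X → ℤ ↦ C *ᵥ x := fun x y hxy ↦ by
    by_contra hne
    have := h.pos (x - y) (sub_ne_zero.2 hne)
    rw [Matrix.mulVec_sub, sub_eq_zero.2 hxy, dotProduct_zero] at this
    exact lt_irrefl _ this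
  refine ((Set.finite_Icc (fun _ : X ↦ (-2 : ℤ)) fun _ ↦ 2).preimage hinj.injOn).subset
    fun x (hx : x ⬝ᵥ C *ᵥ x = 2) ↦ ⟨fun j ↦ ?_, fun j ↦ ?_⟩
  · dsimp only
    rw [← form_single, h.form_comm]
    rcases eq_or_ne (x + Pi.single j 1) 0 with h0 | h0
    · rw [eq_neg_of_add_eq_zero_left h0, neg_dotProduct, h.single_root]
    · have := h.neg_one_le_form hx (h.single_root j) h0
      omega
  · dsimp only
    rw [← form_single, h.form_comm]
    rcases eq_or_ne x (Pi.single j 1) with h0 | h0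
    · rw [h0, h.single_root]
    · have := h.form_le_one hx (h.single_root j) h0
      omega

theorem ne_zero_of_root (hx : x ⬝ᵥ C *ᵥ x = 2) : x ≠ 0 := by
  rintro rfl
  simp at hx

/-- The support of a root is connected. -/
theorem support_connected (h : IsSimplyLacedCartan G C) (hx : x ⬝ᵥ C *ᵥ x = 2) (p : X → Prop)
    (hp : ∀ i j, G.Adj i j → x i ≠ 0 → x j ≠ 0 → p i → p j) (hi : x i ≠ 0) (hpi : p i) (j : X)
    (hj : x j ≠ 0) : p j := by
  classical
  -- If `p` split the support, the two pieces would be orthogonal and nonzero, making the norm at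
  -- least `4`.
  let a : X → ℤ := fun i ↦ if p i then x i else 0
  let b : X → ℤ := fun i ↦ if p i then 0 else x i
  have hab : x = a + b := by
    ext i
    by_cases h : p i <;> simp [a, b, h]
  have hz : a ⬝ᵥ C *ᵥ b = 0 := by
    refine h.form_eq_zero_of_not_adj fun i j hi hj ↦ ?_
    simp only [a, b, ne_eq, ite_eq_right_iff, ite_eq_left_iff, not_forall] at hi hj
    obtain ⟨h₁, h₂⟩ := hi
    obtain ⟨h₃, h₄⟩ := hj
    refine ⟨?_, fun hij ↦ h₃ (hp i j hij h₂ h₄ h₁)⟩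
    rintro rfl
    exact h₃ h₁
  have ha : a ≠ 0 := fun ha ↦ hi (by simpa [a, hpi] using congrFun ha i)
  by_contra hpj
  have hb : b ≠ 0 := fun hb ↦ hj (by simpa [b, hpj] using congrFun hb j)
  have := h.two_le_form ha
  have := h.two_le_form hb
  have := h.form_add_self a b
  rw [← hab] at this
  omega

theorem mulVec_le_neg_one (h : IsSimplyLacedCartan G C) (hx : 0 ≤ x) (hj : x j = 0)
    (hij : G.Adj i j) (hi : 0 < x i) : (C *ᵥ x) j ≤ -1 := by
  classical
  have hle : (C *ᵥ x) j ≤ C j i * x i := by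
    simp only [Matrix.mulVec, dotProduct]
    rw [← Finset.add_sum_erase _ _ (Finset.mem_univ i) (a := i)]
    refine add_le_of_nonpos_right (Finset.sum_nonpos fun k _ ↦ ?_)
    rcases eq_or_ne j k with rfl | hjk
    · simp [hj]
    · exact mul_nonpos_of_nonpos_of_nonneg (h.apply_nonpos hjk) (hx k)
  rw [h.adj j i hij.symm] at hle
  omega

theorem mulVec_nonpos (h : IsSimplyLacedCartan G C) (hx : 0 ≤ x) (hj : x j = 0) :
    (C *ᵥ x) j ≤ 0 := by
  classical
  rw [← form_single]
  refine h.form_nonpos_of_disjoint (by simp [Pi.single_nonneg]) hx fun i ↦ ?_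
  rcases eq_or_ne i j with rfl | hij
  · exact Or.inr hj
  · simp [hij]

theorem mulVec_eq_zero (h : IsSimplyLacedCartan G C)
    (hx : ∀ i, x i ≠ 0 → i ≠ j ∧ ¬ G.Adj i j) : (C *ᵥ x) j = 0 := by
  classical
  rw [← form_single, h.form_comm]
  refine h.form_eq_zero_of_not_adj fun i k hi hk ↦ ?_
  have : k = j := by
    by_contra hkj
    simp [hkj] at hk
  exact this ▸ hx i hi

end IsSimplyLacedCartan

/-! ### Highest roots: uniqueness and pairings -/

namespace IsHighestRoot

variable {X : Type*} [Fintype X] {G : SimpleGraph X} {C : Matrix X X ℤ} {R : Finset X}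
  {x θ θ' : X → ℤ} {i j : X}

theorem nonneg (hθ : IsHighestRoot C R θ) : 0 ≤ θ := fun i ↦ by
  by_cases hi : i ∈ R
  · exact (hθ.pos i hi).le
  · exact (hθ.eq_zero i hi).ge

theorem mem_of_ne_zero (hθ : IsHighestRoot C R θ) (hi : θ i ≠ 0) : i ∈ R := by
  by_contra h
  exact hi (hθ.eq_zero i h)

theorem form_nonneg (hθ : IsHighestRoot C R θ) (hx : 0 ≤ x) (hxR : ∀ i, i ∉ R → x i = 0) :
    0 ≤ x ⬝ᵥ C *ᵥ θ :=
  Finset.sum_nonneg fun i _ ↦ by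
    by_cases hi : i ∈ R
    · exact mul_nonneg (hx i) (hθ.dominant i hi)
    · simp [hxR i hi]

theorem form_pos (hθ : IsHighestRoot C R θ) (hx : ∀ i ∈ R, 0 < x i)
    (hxR : ∀ i, i ∉ R → x i = 0) : 0 < x ⬝ᵥ C *ᵥ θ := by
  have hnn : ∀ i, 0 ≤ x i * (C *ᵥ θ) i := fun i ↦ by
    by_cases hi : i ∈ R
    · exact mul_nonneg (hx i hi).le (hθ.dominant i hi)
    · simp [hxR i hi]
  refine (Finset.sum_nonneg fun i _ ↦ hnn i).lt_of_ne' fun h0 ↦ ?_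
  have hz := (Finset.sum_eq_zero_iff_of_nonneg fun i _ ↦ hnn i).1 h0
  have : θ ⬝ᵥ C *ᵥ θ = 0 := Finset.sum_eq_zero fun i hi ↦ by
    by_cases hiR : i ∈ R
    · rw [(mul_eq_zero.1 (hz i hi)).resolve_left (hx i hiR).ne', mul_zero]
    · simp [hθ.eq_zero i hiR]
  rw [hθ.root] at this
  omega

/-- Two distinct highest roots would pair to exactly `1`, so their difference would be a root and
have a sign. Its pairing with one of them would then contradict dominance, since `1 - 2 < 0`. -/
theorem unique (h : IsSimplyLacedCartan G C) (hθ : IsHighestRoot C R θ)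
    (hθ' : IsHighestRoot C R θ') : θ = θ' := by
  by_contra hne
  have h₁ := h.form_le_one hθ.root hθ'.root hne
  have h₂ := hθ'.form_pos hθ.pos hθ.eq_zero
  have hroot : (θ - θ') ⬝ᵥ C *ᵥ (θ - θ') = 2 := by
    rw [h.form_sub_self, hθ.root, hθ'.root]
    omega
  have hsupp : ∀ i, i ∉ R → (θ - θ') i = 0 := fun i hi ↦ by
    simp [hθ.eq_zero i hi, hθ'.eq_zero i hi]
  rcases h.nonneg_or_nonpos hroot with hs | hs
  · have := hθ'.form_nonneg hs hsupp
    rw [sub_dotProduct, hθ'.root] at this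
    omega
  · have := hθ.form_nonneg (x := -(θ - θ')) (neg_nonneg.2 hs)
      fun i hi ↦ by rw [Pi.neg_apply, hsupp i hi, neg_zero]
    rw [neg_sub, sub_dotProduct, hθ.root, h.form_comm] at this
    omega

theorem mulVec_of_notMem (h : IsSimplyLacedCartan G C) (hθ : IsHighestRoot C R θ) (hj : j ∉ R)
    [Decidable (∃ i ∈ R, G.Adj i j)] :
    (C *ᵥ θ) j = if ∃ i ∈ R, G.Adj i j then -1 else 0 := by
  classical
  split_ifs with hex
  · obtain ⟨i, hi, hij⟩ := hex
    refine le_antisymm (h.mulVec_le_neg_one hθ.nonneg (hθ.eq_zero j hj) hij (hθ.pos i hi)) ?_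
    rw [← IsSimplyLacedCartan.form_single]
    refine h.neg_one_le_form (h.single_root j) hθ.root fun h0 ↦ ?_
    have := congrFun h0 j
    simp [hθ.eq_zero j hj] at this
  · refine h.mulVec_eq_zero fun i hi ↦ ⟨?_, fun hij ↦ hex ⟨i, hθ.mem_of_ne_zero hi, hij⟩⟩
    rintro rfl
    exact hj (hθ.mem_of_ne_zero hi)

/-- A zero coefficient next to a positive one would give a negative pairing, so positivity spreads
over the connected set `R`. -/
theorem of_dominant (h : IsSimplyLacedCartan G C) (hR : IsConnectedFinset G R)
    (hx : x ⬝ᵥ C *ᵥ x = 2) (hxR : ∀ i, i ∉ R → x i = 0) (hd : ∀ i ∈ R, 0 ≤ (C *ᵥ x) i) :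
    IsHighestRoot C R x := by
  have hnn : 0 ≤ x := by
    refine (h.nonneg_or_nonpos hx).resolve_right fun hs ↦ ?_
    have : x ⬝ᵥ C *ᵥ x ≤ 0 := Finset.sum_nonpos fun i _ ↦ by
      by_cases hi : i ∈ R
      · exact mul_nonpos_of_nonpos_of_nonneg (hs i) (hd i hi)
      · simp [hxR i hi]
    omega
  refine ⟨hx, hxR, ?_, hd⟩
  obtain ⟨i, hi⟩ := Function.ne_iff.1 (IsSimplyLacedCartan.ne_zero_of_root hx)
  have hiR : i ∈ R := by
    by_contra hc
    exact hi (hxR i hc)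
  refine hR.induction (fun i ↦ 0 < x i) (fun i _ j hj hij hpi ↦ ?_) i hiR
    ((hnn i).lt_of_ne' hi)
  refine (hnn j).lt_of_ne' fun h0 ↦ ?_
  have h₁ := h.mulVec_le_neg_one hnn h0 hij hpi
  have h₂ := hd j hj
  omega

end IsHighestRoot

/-! ### Words in simple reflections, dominant representatives, climbing to the highest root -/

section Words

variable {X : Type*} {C : Matrix X X ℤ}

/-- The action of the simple reflection `sⱼ` on weights, in the basis of fundamental weights. -/
def simpleReflWeight (C : Matrix X X ℤ) (j : X) (f : X → ℤ) : X → ℤ :=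
  fun k ↦ f k - f j * C k j

/-- The action of the simple reflection `sⱼ` on the root lattice, in the basis of simple roots. -/
def simpleReflRoot [Fintype X] [DecidableEq X] (C : Matrix X X ℤ) (j : X) (x : X → ℤ) : X → ℤ :=
  x - Pi.single j ((C *ᵥ x) j)

/-- The action of a word in the simple reflections on weights. -/
def wordWeight (C : Matrix X X ℤ) (L : List X) (f : X → ℤ) : X → ℤ :=
  L.foldr (simpleReflWeight C) f

/-- The action of a word in the simple reflections on the root lattice. -/
def wordRoot [Fintype X] [DecidableEq X] (C : Matrix X X ℤ) (L : List X) (x : X → ℤ) : X → ℤ :=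
  L.foldr (simpleReflRoot C) x

variable {L L' : List X} {j k : X} {f g x y : X → ℤ}

@[simp] theorem wordWeight_nil : wordWeight C [] f = f := rfl

@[simp] theorem wordRoot_nil [Fintype X] [DecidableEq X] : wordRoot C [] x = x := rfl

@[simp] theorem wordWeight_cons :
    wordWeight C (j :: L) f = simpleReflWeight C j (wordWeight C L f) := rfl

@[simp] theorem wordRoot_cons [Fintype X] [DecidableEq X] :
    wordRoot C (j :: L) x = simpleReflRoot C j (wordRoot C L x) := rfl

theorem wordWeight_append :
    wordWeight C (L ++ L') f = wordWeight C L (wordWeight C L' f) := List.foldr_append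

theorem wordRoot_append [Fintype X] [DecidableEq X] :
    wordRoot C (L ++ L') x = wordRoot C L (wordRoot C L' x) := List.foldr_append

theorem simpleReflRoot_of_ne [Fintype X] [DecidableEq X] (hk : k ≠ j) : simpleReflRoot C j x k = x k := by
  simp [simpleReflRoot, hk]

theorem simpleReflWeight_add :
    simpleReflWeight C j (f + g) = simpleReflWeight C j f + simpleReflWeight C j g := by
  ext k
  simp [simpleReflWeight]
  ring

theorem wordWeight_add : wordWeight C L (f + g) = wordWeight C L f + wordWeight C L g := by
  induction L with
  | nil => rfl
  | cons i L ih => simp [ih, simpleReflWeight_add]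

theorem simpleReflWeight_eq_self (hf : f j = 0) : simpleReflWeight C j f = f := by
  funext k
  simp [simpleReflWeight, hf]

theorem wordWeight_eq_self (hf : ∀ j ∈ L, f j = 0) : wordWeight C L f = f := by
  induction L with
  | nil => rfl
  | cons i L ih =>
    rw [wordWeight_cons, ih fun j hj ↦ hf j (List.mem_cons_of_mem _ hj),
      simpleReflWeight_eq_self (hf i List.mem_cons_self)]

variable [Fintype X] [DecidableEq X] {G : SimpleGraph X}

namespace IsSimplyLacedCartan

variable (h : IsSimplyLacedCartan G C)
include h

theorem simpleReflWeight_dot : simpleReflWeight C j f ⬝ᵥ simpleReflRoot C j x = f ⬝ᵥ x := by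
  have h₁ : C.col j ⬝ᵥ x = (C *ᵥ x) j := by
    simp only [dotProduct, Matrix.mulVec, Matrix.col_apply, h.apply_comm j]
  have h₂ : simpleReflWeight C j f ⬝ᵥ x = f ⬝ᵥ x - f j * (C *ᵥ x) j := by
    rw [← h₁, dotProduct, dotProduct, dotProduct, Finset.mul_sum, ← Finset.sum_sub_distrib]
    exact Finset.sum_congr rfl fun k _ ↦ by simp only [simpleReflWeight, Matrix.col_apply]; ring
  rw [simpleReflRoot, dotProduct_sub, dotProduct_single, h₂]
  simp only [simpleReflWeight, h.diag]
  ring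

omit h in
theorem simpleReflWeight_mulVec :
    simpleReflWeight C j (C *ᵥ x) = C *ᵥ simpleReflRoot C j x := by
  ext k
  simp [simpleReflWeight, simpleReflRoot, Matrix.mulVec_sub, mul_comm]

omit [DecidableEq X] in
theorem simpleReflWeight_self : simpleReflWeight C j (simpleReflWeight C j f) = f := by
  ext k
  simp [simpleReflWeight, h.diag]
  ring

theorem wordWeight_dot : wordWeight C L f ⬝ᵥ wordRoot C L x = f ⬝ᵥ x := by
  induction L with
  | nil => rfl
  | cons i L ih => rw [wordWeight_cons, wordRoot_cons, h.simpleReflWeight_dot, ih]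

omit h in
theorem wordWeight_mulVec : wordWeight C L (C *ᵥ x) = C *ᵥ wordRoot C L x := by
  induction L with
  | nil => rfl
  | cons i L ih => rw [wordWeight_cons, wordRoot_cons, ih, simpleReflWeight_mulVec]

theorem wordRoot_form : wordRoot C L x ⬝ᵥ C *ᵥ wordRoot C L y = x ⬝ᵥ C *ᵥ y := by
  rw [← wordWeight_mulVec, dotProduct_comm, h.wordWeight_dot, dotProduct_comm]

theorem simpleReflRoot_root (hx : x ⬝ᵥ C *ᵥ x = 2) :
    simpleReflRoot C j x ⬝ᵥ C *ᵥ simpleReflRoot C j x = 2 :=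
  (h.wordRoot_form (L := [j])).trans hx

omit [DecidableEq X] in
theorem wordWeight_reverse : wordWeight C L.reverse (wordWeight C L f) = f := by
  induction L with
  | nil => rfl
  | cons i L ih =>
    rw [List.reverse_cons, wordWeight_append, wordWeight_cons, wordWeight_cons, wordWeight_nil,
      h.simpleReflWeight_self, ih]

theorem eq_single_of_root (hx : x ⬝ᵥ C *ᵥ x = 2) (hnn : 0 ≤ x)
    (hz : ∀ k, k ≠ j → x k = 0) : x = Pi.single j 1 := by
  have hx' : x = Pi.single j (x j) := by
    ext k
    rcases eq_or_ne k j with rfl | hk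
    · simp
    · simp [hz k hk, hk]
  have hxx : x j * x j = 1 := by
    rw [hx'] at hx
    simp [h.diag] at hx
    linarith
  have hj : x j = 1 := by
    have := hnn j
    simp only [Pi.zero_apply] at this
    nlinarith
  rw [hx', hj]

/-- A simple reflection permutes the positive roots other than its own simple root. -/
theorem simpleReflRoot_nonneg (hx : x ⬝ᵥ C *ᵥ x = 2) (hnn : 0 ≤ x)
    (hne : x ≠ Pi.single j 1) : 0 ≤ simpleReflRoot C j x := by
  refine (h.nonneg_or_nonpos (h.simpleReflRoot_root hx)).resolve_right fun hs ↦ hne ?_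
  refine h.eq_single_of_root hx hnn fun k hk ↦ (hnn k).antisymm' ?_
  rw [← simpleReflRoot_of_ne (C := C) (x := x) hk]
  exact hs k

/-- Some letter `i` is the first to make the image of `αₖ` negative. The image just before it must
be `αᵢ`, so the part `w` of the word already applied satisfies `w sₖ = sᵢ w`, and the letter `i`
cancels. -/
theorem exchange (L : List X) (k : X) (hL : ¬ 0 ≤ wordRoot C L (Pi.single k 1)) :
    ∃ L' : List X, L'.length + 1 = L.length ∧
      ∀ f, wordWeight C L (simpleReflWeight C k f) = wordWeight C L' f := by
  induction L with
  | nil => exact absurd (by simp [Pi.single_nonneg]) hL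
  | cons i L ih =>
    by_cases hnn : 0 ≤ wordRoot C L (Pi.single k 1)
    · have hsingle : wordRoot C L (Pi.single k 1) = Pi.single i 1 := by
        by_contra hne
        exact hL (h.simpleReflRoot_nonneg ((h.wordRoot_form).trans (h.single_root k)) hnn hne)
      refine ⟨L, rfl, fun f ↦ ?_⟩
      -- Applying `w` to `f = sₖ f + f(k) αₖ`, with `w αₖ = αᵢ` and `⟨w f, αᵢ^∨⟩ = f(k)`, gives `w
      -- sₖ f = sᵢ w f`.
      have hk : f = simpleReflWeight C k f + C *ᵥ Pi.single k (f k) := by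
        ext l
        simp [simpleReflWeight, mul_comm]
      have hfk : (wordWeight C L f) i = f k := by
        have := h.wordWeight_dot (L := L) (f := f) (x := Pi.single k 1)
        simpa [hsingle] using this
      have hs : wordRoot C L (Pi.single k (f k)) = Pi.single i (f k) := by
        have hlin : ∀ (L : List X) (c : ℤ) (x : X → ℤ),
            wordRoot C L (c • x) = c • wordRoot C L x := by
          intro L c x
          induction L with
          | nil => rfl
          | cons i L ih =>
            rw [wordRoot_cons, ih, wordRoot_cons, simpleReflRoot, simpleReflRoot,
              Matrix.mulVec_smul, Pi.smul_apply, smul_sub, Pi.single_smul]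
        have h1 : ∀ j : X, Pi.single j (f k) = f k • (Pi.single j 1 : X → ℤ) := fun j ↦ by
          rw [← Pi.single_smul, smul_eq_mul, mul_one]
        rw [h1, hlin, hsingle, ← h1]
      have key : wordWeight C L f = wordWeight C L (simpleReflWeight C k f)
          + C *ᵥ Pi.single i (f k) := by
        conv_lhs => rw [hk]
        rw [wordWeight_add, wordWeight_mulVec, hs]
      have key' : wordWeight C L (simpleReflWeight C k f)
          = simpleReflWeight C i (wordWeight C L f) := by
        rw [eq_sub_of_add_eq key.symm]
        ext l
        simp [simpleReflWeight, hfk, mul_comm]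
      rw [wordWeight_cons, key', h.simpleReflWeight_self]
    · obtain ⟨L', hlen, hL'⟩ := ih hnn
      exact ⟨i :: L', by simp [hlen], fun f ↦ by simp [hL']⟩

/-- Two dominant weights in the same Weyl group orbit are equal. -/
theorem eq_of_dominant (hf : 0 ≤ f) (hg : 0 ≤ g) (L : List X) (hL : wordWeight C L f = g) :
    f = g := by
  induction hn : L.length using Nat.strong_induction_on generalizing L with
  | _ n ih =>
    rcases List.eq_nil_or_concat L with rfl | ⟨L, k, rfl⟩
    · exact hL
    rw [List.concat_eq_append] at hL hn
    rw [wordWeight_append, wordWeight_cons, wordWeight_nil] at hL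
    simp only [List.length_append, List.length_singleton] at hn
    -- If `w αₖ` is positive, its pairing with the dominant `g` is both nonnegative and `-f k`, so
    -- `f k = 0` and the letter `k` acts trivially. Otherwise the exchange property shortens the
    -- word.
    by_cases hnn : 0 ≤ wordRoot C L (Pi.single k 1)
    · have h₁ : g ⬝ᵥ wordRoot C L (Pi.single k 1) = -f k := by
        rw [← hL, h.wordWeight_dot]
        simp [simpleReflWeight, h.diag]
        ring
      have h₂ : 0 ≤ g ⬝ᵥ wordRoot C L (Pi.single k 1) :=
        Finset.sum_nonneg fun i _ ↦ mul_nonneg (hg i) (hnn i)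
      have h₃ : 0 ≤ f k := hf k
      rw [simpleReflWeight_eq_self (by omega)] at hL
      exact ih L.length (by omega) L hL rfl
    · obtain ⟨L', hlen, hL'⟩ := h.exchange L k hnn
      exact ih L'.length (by omega) L' ((hL' f).symm.trans hL) rfl

/-- Reflecting in a simple root of `R` with negative pairing raises the coefficient sum, which is
bounded as there are finitely many roots. The climb stops at a root dominant on `R`. -/
theorem exists_word_isHighestRoot {R : Finset X} (hR : IsConnectedFinset G R)
    (hx : x ⬝ᵥ C *ᵥ x = 2) (hxR : ∀ i, i ∉ R → x i = 0) :
    ∃ L : List X, (∀ j ∈ L, j ∈ R) ∧ IsHighestRoot C R (wordRoot C L x) ∧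
      x ≤ wordRoot C L x := by
  obtain ⟨B, hB⟩ := (h.finite_roots.image fun x : X → ℤ ↦ ∑ i, x i).bddAbove
  induction hn : (B - ∑ i, x i).toNat using Nat.strong_induction_on generalizing x with
  | _ n ih =>
    by_cases hd : ∀ i ∈ R, 0 ≤ (C *ᵥ x) i
    · exact ⟨[], by simp, .of_dominant h hR hx hxR hd, le_rfl⟩
    push Not at hd
    obtain ⟨j, hj, hneg⟩ := hd
    have hroot := h.simpleReflRoot_root (j := j) hx
    have hle : x ≤ simpleReflRoot C j x := by
      intro k
      rcases eq_or_ne k j with rfl | hk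
      · simp [simpleReflRoot]
        omega
      · rw [simpleReflRoot_of_ne hk]
    have hsum : ∑ i, x i < ∑ i, simpleReflRoot C j x i := by
      refine Finset.sum_lt_sum (fun i _ ↦ hle i) ⟨j, Finset.mem_univ j, ?_⟩
      simp [simpleReflRoot]
      omega
    have hb : ∑ i, simpleReflRoot C j x i ≤ B := hB ⟨_, hroot, rfl⟩
    obtain ⟨L, hL₁, hL₂, hL₃⟩ := ih _ (by omega) hroot (fun i hi ↦ by
      rw [simpleReflRoot_of_ne (by rintro rfl; exact hi hj), hxR i hi]) rfl
    have happ : wordRoot C (L ++ [j]) x = wordRoot C L (simpleReflRoot C j x) := by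
      rw [wordRoot_append, wordRoot_cons, wordRoot_nil]
    refine ⟨L ++ [j], ?_, happ ▸ hL₂, happ ▸ hle.trans hL₃⟩
    intro i hi
    rcases List.mem_append.1 hi with hi | hi
    · exact hL₁ i hi
    · rwa [List.mem_singleton.1 hi]

omit [DecidableEq X] in
theorem exists_isHighestRoot {R : Finset X} (hR : IsConnectedFinset G R) :
    ∃ θ, IsHighestRoot C R θ := by
  classical
  obtain ⟨i, hi⟩ := hR.nonempty
  obtain ⟨L, -, hL, -⟩ := h.exists_word_isHighestRoot hR (h.single_root i) fun j hj ↦ by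
    rw [Pi.single_eq_of_ne]
    rintro rfl
    exact hj hi
  exact ⟨_, hL⟩

end IsSimplyLacedCartan

omit [DecidableEq X] in
theorem IsHighestRoot.le (h : IsSimplyLacedCartan G C) {R : Finset X} {θ : X → ℤ}
    (hR : IsConnectedFinset G R) (hθ : IsHighestRoot C R θ) (hx : x ⬝ᵥ C *ᵥ x = 2)
    (hxR : ∀ i, i ∉ R → x i = 0) : x ≤ θ := by
  classical
  obtain ⟨L, -, hL, hle⟩ := h.exists_word_isHighestRoot hR hx hxR
  rwa [hθ.unique h hL]

end Words

/-! ### Affine completions and highest roots -/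

section Affine

variable {X : Type*} [Fintype X] {G : SimpleGraph X} {C : Matrix X X ℤ} {R : Finset X}
  {θ : X → ℤ} {A : Matrix (Option R) (Option R) ℕ}

/-- Only the block of `A` on `R` is constrained, so this also applies to a matrix not yet known to
be affine. -/
theorem IsSimplyLacedCartan.mulVec_apply_of_completion (h : IsSimplyLacedCartan G C)
    (hA₁ : ∀ i j : R, G.Adj i j → A (some i) (some j) = 1)
    (hA₂ : ∀ i j : R, ¬ G.Adj i j → A (some i) (some j) = 0)
    {x : X → ℤ} (hx : ∀ i, i ∉ R → x i = 0) (i : R) :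
    (C *ᵥ x) i = 2 * x i - ∑ k : R, (A (some i) (some k) : ℤ) * x k := by
  classical
  have h₁ : (C *ᵥ x) i = ∑ k : R, C i k * x k := by
    rw [Finset.sum_coe_sort R fun k ↦ C i k * x k]
    refine (Finset.sum_subset (Finset.subset_univ R) fun k _ hk ↦ ?_).symm
    rw [hx k hk, mul_zero]
  have h₂ : ∀ k : R, C i k = (if k = i then 2 else 0) - (A (some i) (some k) : ℤ) := fun k ↦ by
    rcases eq_or_ne k i with rfl | hk
    · simp [h.diag, hA₂ k k (G.loopless.irrefl _)]
    by_cases ha : G.Adj i k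
    · simp [hk, h.adj _ _ ha, hA₁ _ _ ha]
    · simp [hk, h.not_adj _ _ (fun he ↦ hk (Subtype.ext he.symm)) ha, hA₂ _ _ ha]
  simp [h₁, h₂, sub_mul, Finset.sum_sub_distrib]

/-- The marks of an affine completion are the coefficients of the highest root. -/
theorem IsAffineCompletion.apply_none (h : IsSimplyLacedCartan G C)
    (hA : IsAffineCompletion G R A) (hθ : IsHighestRoot C R θ) (j : R) :
    (A none (some j) : ℤ) = (C *ᵥ θ) j := by
  classical
  obtain ⟨δ, hδ, hmark, hδ0⟩ := hA.affine.marks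
  -- The mark equations at the nodes of `R` say that `C *ᵥ x` is the row of the affine node; the one
  -- at the affine node says that `x` has norm `2`.
  let x : X → ℤ := fun i ↦ if hi : i ∈ R then (δ (some ⟨i, hi⟩) : ℤ) else 0
  have hxR : ∀ i, i ∉ R → x i = 0 := fun i hi ↦ by simp [x, hi]
  have hxδ : ∀ i : R, x i = δ (some i) := fun i ↦ by simp [x]
  have hC : ∀ i : R, (C *ᵥ x) i = A none (some i) := fun i ↦ by
    have := hmark (some i)
    rw [Fintype.sum_option, hδ0, mul_one, hA.affine.symm] at this
    rw [h.mulVec_apply_of_completion hA.adj hA.not_adj hxR]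
    simp only [hxδ]
    zify at this
    linarith
  have hroot : x ⬝ᵥ C *ᵥ x = 2 := by
    have h₁ : x ⬝ᵥ C *ᵥ x = ∑ k : R, x k * (C *ᵥ x) k := by
      rw [Finset.sum_coe_sort R fun k ↦ x k * (C *ᵥ x) k]
      refine (Finset.sum_subset (Finset.subset_univ R) fun k _ hk ↦ ?_).symm
      rw [hxR k hk, zero_mul]
    have := hmark none
    rw [Fintype.sum_option, hA.affine.loopless, hδ0] at this
    rw [h₁]
    simp only [hC, hxδ]
    zify at this
    simpa [mul_comm] using this
  have hx : IsHighestRoot C R x := by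
    refine ⟨hroot, hxR, fun i hi ↦ ?_, fun i hi ↦ ?_⟩
    · rw [hxδ ⟨i, hi⟩]
      exact_mod_cast hδ _
    · rw [hC ⟨i, hi⟩]
      positivity
  rw [hθ.unique h hx, hC]

/-- The new node plays the role of `-θ`: it gets `⟨θ, αⱼ^∨⟩` edges to `j`, and the marks are `1`
there and `θ` on `R`. -/
theorem IsHighestRoot.exists_isAffineCompletion (h : IsSimplyLacedCartan G C)
    (hR : IsConnectedFinset G R) (hθ : IsHighestRoot C R θ) :
    ∃ A : Matrix (Option R) (Option R) ℕ, IsAffineCompletion G R A := by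
  classical
  let A : Matrix (Option R) (Option R) ℕ := fun v w ↦
    match v, w with
    | none, none => 0
    | none, some j => ((C *ᵥ θ) j).toNat
    | some i, none => ((C *ᵥ θ) i).toNat
    | some i, some j => if G.Adj i j then 1 else 0
  have hA₁ : ∀ i j : R, G.Adj i j → A (some i) (some j) = 1 := fun i j hij ↦ if_pos hij
  have hA₂ : ∀ i j : R, ¬ G.Adj i j → A (some i) (some j) = 0 := fun i j hij ↦ if_neg hij
  have hA₃ : ∀ j : R, (A none (some j) : ℤ) = (C *ᵥ θ) j := fun j ↦
    Int.toNat_of_nonneg (hθ.dominant j j.2)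
  have hA₄ : ∀ j : R, A (some j) none = A none (some j) := fun j ↦ rfl
  have hA₅ : A none none = 0 := rfl
  have hsymm : ∀ v w, A v w = A w v := by
    rintro (_ | i) (_ | j)
    · rfl
    · rfl
    · rfl
    · by_cases hij : G.Adj i j
      · rw [hA₁ i j hij, hA₁ j i hij.symm]
      · rw [hA₂ i j hij, hA₂ j i fun h ↦ hij h.symm]
  have hmulVec := h.mulVec_apply_of_completion hA₁ hA₂ hθ.eq_zero
  have hpair : ∑ k : R, (C *ᵥ θ) k * θ k = 2 := by
    rw [← hθ.root, Finset.sum_coe_sort R fun k ↦ (C *ᵥ θ) k * θ k, dotProduct_comm]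
    refine Finset.sum_subset (Finset.subset_univ R) fun k _ hk ↦ ?_
    rw [hθ.eq_zero k hk, mul_zero]
  clear_value A
  refine ⟨A, hA₁, hA₂, hsymm, ?_, ?_, fun v ↦ v.elim 1 fun i ↦ (θ i).toNat, ?_, ?_, rfl⟩
  · rintro (_ | i)
    · exact hA₅
    · exact hA₂ i i (G.loopless.irrefl _)
  · let Γ := SimpleGraph.fromRel fun v w => A v w ≠ 0
    obtain ⟨k, hk⟩ : ∃ k : R, A none (some k) ≠ 0 := by
      by_contra! hc
      have : ∑ k : R, (C *ᵥ θ) k * θ k = 0 := Finset.sum_eq_zero fun k _ ↦ by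
        rw [← hA₃, hc k]
        simp
      omega
    have hadj : Γ.Adj none (some k) := by simp [Γ, hk]
    refine SimpleGraph.connected_iff_exists_forall_reachable _ |>.2 ⟨some k, ?_⟩
    rintro (_ | j)
    · exact hadj.symm.reachable
    · have := hR.induction (fun i ↦ ∀ hi : i ∈ R, Γ.Reachable (some k) (some ⟨i, hi⟩))
        (fun i hi j hj hij hr _ ↦ (hr hi).trans (SimpleGraph.Adj.reachable ?_)) k k.2
        (fun _ ↦ .rfl) j j.2 j.2
      · exact this
      · have hne : (⟨i, hi⟩ : R) ≠ ⟨j, hj⟩ := fun he ↦ hij.ne (congrArg Subtype.val he)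
        simp [Γ, hne, hA₁ ⟨i, hi⟩ ⟨j, hj⟩ hij]
  · rintro (_ | i)
    · exact one_pos
    · exact Int.lt_toNat.2 (hθ.pos i i.2)
  · have hθ' : ∀ i : R, ((θ i).toNat : ℤ) = θ i := fun i ↦ Int.toNat_of_nonneg (hθ.nonneg i)
    rintro (_ | i)
    · zify
      simpa [Fintype.sum_option, hA₅, hA₃, hθ'] using hpair
    · zify
      have := hmulVec i
      rw [← hA₃] at this
      simp [Fintype.sum_option, hA₄, hθ', this]

variable {f f' : X → ℕ}

/-- A UCF move adds the highest root of the zero component. -/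
theorem ucfMoveAlong_iff (h : IsSimplyLacedCartan G C) (hθ : IsHighestRoot C R θ) :
    UCFMoveAlong G f R f' ↔ IsZeroComponent G f R ∧ ∀ j, (f' j : ℤ) = f j + (C *ᵥ θ) j := by
  classical
  refine and_congr_right fun hz ↦ ?_
  have key : ∀ A, IsAffineCompletion G R A → ∀ j,
      (f j : ℤ) + (if h : j ∈ R then (A none (some ⟨j, h⟩) : ℤ) else 0)
        - (if j ∉ R ∧ ∃ i ∈ R, G.Adj i j then 1 else 0) = f j + (C *ᵥ θ) j := fun A hA j ↦ by
    by_cases hj : j ∈ R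
    · simp [hj, hA.apply_none h hθ]
    · rw [hθ.mulVec_of_notMem h hj]
      by_cases hex : ∃ i ∈ R, G.Adj i j
      · simp only [hj, not_false_eq_true, true_and, hex, if_true, dite_false]
        ring
      · simp only [hj, not_false_eq_true, true_and, hex, if_false, dite_false]
        ring
  constructor
  · rintro ⟨A, hA, hf⟩ j
    rw [← key A hA j, hf j]
  · intro hf
    obtain ⟨A, hA⟩ := hθ.exists_isAffineCompletion h hz.isConnectedFinset
    refine ⟨A, hA, fun j ↦ ?_⟩
    rw [hf j, ← key A hA j]

theorem IsZeroComponent.add_mulVec_nonneg (h : IsSimplyLacedCartan G C)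
    (hz : IsZeroComponent G f R) (hθ : IsHighestRoot C R θ) (j : X) :
    0 ≤ (f j : ℤ) + (C *ᵥ θ) j := by
  classical
  by_cases hj : j ∈ R
  · have := hθ.dominant j hj
    positivity
  · rw [hθ.mulVec_of_notMem h hj]
    split_ifs with hex
    · obtain ⟨i, hi, hij⟩ := hex
      have : f j ≠ 0 := fun h0 ↦ hj (hz.mem_of_adj hi hij h0)
      omega
    · positivity

theorem IsZeroComponent.existsUnique_ucfMoveAlong (h : IsSimplyLacedCartan G C)
    (hz : IsZeroComponent G f R) : ∃! f', UCFMoveAlong G f R f' := by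
  classical
  obtain ⟨θ, hθ⟩ := h.exists_isHighestRoot hz.isConnectedFinset
  refine ⟨fun j ↦ ((f j : ℤ) + (C *ᵥ θ) j).toNat, (ucfMoveAlong_iff h hθ).2 ⟨hz, fun j ↦
    Int.toNat_of_nonneg (hz.add_mulVec_nonneg h hθ j)⟩, fun g hg ↦ funext fun j ↦ ?_⟩
  have := ((ucfMoveAlong_iff h hθ).1 hg).2 j
  omega

end Affine

/-! ### Commutation of UCF moves -/

section Commute

variable {X : Type*} [Fintype X] {G : SimpleGraph X} {C : Matrix X X ℤ}
  {f f₁ f₂ : X → ℕ} {R R₁ R₂ R₁' R₂' : Finset X} {x θ θ₁ θ₂ θ₁' θ₂' : X → ℤ}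

theorem IsZeroComponent.dotProduct_eq_zero (hz : IsZeroComponent G f R)
    (hx : ∀ i, i ∉ R → x i = 0) : (fun i ↦ (f i : ℤ)) ⬝ᵥ x = 0 :=
  Finset.sum_eq_zero fun i _ ↦ by
    by_cases hi : i ∈ R
    · simp [hz.eq_zero hi]
    · simp [hx i hi]

omit [Fintype X] in
theorem IsZeroComponent.not_adj_of_ne (hz₁ : IsZeroComponent G f R₁)
    (hz₂ : IsZeroComponent G f R₂) (hne : R₁ ≠ R₂) {i j : X} (hi : i ∈ R₁) (hj : j ∈ R₂) :
    i ≠ j ∧ ¬ G.Adj i j := by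
  constructor
  · rintro rfl
    exact hne (hz₁.eq_of_mem hz₂ hj hi)
  · intro hij
    exact hne (hz₁.eq_of_mem hz₂ hj (hz₁.mem_of_adj hi hij (hz₂.eq_zero hj)))

theorem nonneg_dotProduct_of_natCast (hx : 0 ≤ x) : 0 ≤ (fun i ↦ (f i : ℤ)) ⬝ᵥ x :=
  Finset.sum_nonneg fun i _ ↦ mul_nonneg (by positivity) (hx i)

/-- If a zero component `R₂` is enlarged by one vertex of weight `1`, of coefficient `1` in
the new highest root, then the old and the new highest roots pair to `1`. -/
theorem IsHighestRoot.form_eq_one_of_dotProduct_eq_one (h : IsSimplyLacedCartan G C)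
    (hz : IsZeroComponent G f R) (hθ : IsHighestRoot C R θ) (hsub : R ⊆ R₁')
    (hθ' : IsHighestRoot C R₁' θ') (hf : (fun i ↦ (f i : ℤ)) ⬝ᵥ θ' = 1) :
    θ ⬝ᵥ C *ᵥ θ' = 1 := by
  classical
  have hne : θ ≠ θ' := by
    rintro rfl
    rw [hz.dotProduct_eq_zero hθ.eq_zero] at hf
    omega
  have hle := h.form_le_one hθ.root hθ'.root hne
  have hnn : 0 ≤ θ ⬝ᵥ C *ᵥ θ' :=
    hθ'.form_nonneg hθ.nonneg fun i hi ↦ hθ.eq_zero i fun hiR ↦ hi (hsub hiR)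
  by_contra hne1
  -- The pairing is `0` or `1`. If it were `0`, then `θ'` would be orthogonal to all of `R`; the
  -- part `a` of `θ'` on `R` is shown below to equal `θ`, although `θ` pairs with `a` to at most
  -- `1`.
  have hB : θ ⬝ᵥ C *ᵥ θ' = 0 := by omega
  have horth : ∀ i ∈ R, (C *ᵥ θ') i = 0 := fun i hi ↦ by
    have hz' := (Finset.sum_eq_zero_iff_of_nonneg fun i _ ↦ ?_).1 hB i (Finset.mem_univ i)
    · exact (mul_eq_zero.1 hz').resolve_left (hθ.pos i hi).ne'
    · by_cases hiR : i ∈ R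
      · exact mul_nonneg (hθ.nonneg i) (hθ'.dominant i (hsub hiR))
      · simp [hθ.eq_zero i hiR]
  -- the unique vertex `j` of nonzero weight in the support of `θ'`
  obtain ⟨j, hj⟩ : ∃ j, (f j : ℤ) * θ' j ≠ 0 := by
    by_contra! hc
    rw [dotProduct, Finset.sum_eq_zero fun i _ ↦ hc i] at hf
    omega
  have hfnn : ∀ i, 0 ≤ (f i : ℤ) * θ' i := fun i ↦ mul_nonneg (by positivity) (hθ'.nonneg i)
  rw [dotProduct, ← Finset.add_sum_erase _ _ (Finset.mem_univ j)] at hf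
  have hrest := Finset.sum_nonneg fun i (_ : i ∈ Finset.univ.erase j) ↦ hfnn i
  have hjnn := hfnn j
  have hj1 : (f j : ℤ) * θ' j = 1 := by omega
  have hrest0 : ∀ i, i ≠ j → f i = 0 ∨ θ' i = 0 := fun i hij ↦ by
    have := (Finset.sum_eq_zero_iff_of_nonneg fun i _ ↦ hfnn i).1
      (by omega : ∑ i ∈ Finset.univ.erase j, (f i : ℤ) * θ' i = 0) i (by simp [hij])
    exact_mod_cast mul_eq_zero.1 this
  have hθj : θ' j = 1 := Int.eq_one_of_mul_eq_one_left (hθ'.nonneg j) hj1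
  have hfj : f j ≠ 0 := fun h0 ↦ hj (by simp [h0])
  have hjR : j ∉ R := fun hjR ↦ hfj (hz.eq_zero hjR)
  have hjR' : j ∈ R₁' := hθ'.mem_of_ne_zero (by omega)
  -- `θ' = a + αⱼ + d` with `a` supported on `R` and `d` orthogonal to `R`
  let a : X → ℤ := fun i ↦ if i ∈ R then θ' i else 0
  let d : X → ℤ := fun i ↦ if i ∈ R ∨ i = j then 0 else θ' i
  have hdecomp : θ' = a + Pi.single j 1 + d := by
    ext i
    by_cases hi : i ∈ R
    · have : i ≠ j := by rintro rfl; exact hjR hi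
      simp [a, d, hi, this]
    · rcases eq_or_ne i j with rfl | hij
      · simp [a, d, hi, hθj]
      · simp [a, d, hi, hij]
  have haR : ∀ i, i ∉ R → a i = 0 := fun i hi ↦ by simp [a, hi]
  have hapos : ∀ i ∈ R, 0 < a i := fun i hi ↦ by simp [a, hi, hθ'.pos i (hsub hi)]
  have hdR : ∀ i ∈ R, (C *ᵥ d) i = 0 := fun i hi ↦ by
    refine h.mulVec_eq_zero fun k hk ↦ ?_
    simp only [d, ne_eq, ite_eq_left_iff, not_or, not_forall] at hk
    obtain ⟨⟨hkR, hkj⟩, hk'⟩ := hk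
    refine ⟨by rintro rfl; exact hkR hi, fun hki ↦ hkR (hz.mem_of_adj hi hki.symm ?_)⟩
    exact (hrest0 k hkj).resolve_right hk'
  have haC : ∀ i ∈ R, (C *ᵥ a) i = -(C *ᵥ Pi.single j 1) i := fun i hi ↦ by
    have := horth i hi
    rw [hdecomp, Matrix.mulVec_add, Matrix.mulVec_add, Pi.add_apply, Pi.add_apply, hdR i hi] at this
    omega
  have hform : ∀ y : X → ℤ, (∀ i, i ∉ R → y i = 0) → y ⬝ᵥ C *ᵥ a = -(C *ᵥ y) j := fun y hy ↦ by
    rw [← IsSimplyLacedCartan.form_single, h.form_comm (Pi.single j 1), dotProduct, dotProduct,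
      ← Finset.sum_neg_distrib]
    refine Finset.sum_congr rfl fun i _ ↦ ?_
    by_cases hi : i ∈ R
    · rw [haC i hi, mul_neg]
    · rw [hy i hi, zero_mul, zero_mul, neg_zero]
  have hθa : θ ⬝ᵥ C *ᵥ a ≤ 1 := by
    rw [hform θ hθ.eq_zero, hθ.mulVec_of_notMem h hjR]
    split_ifs <;> omega
  -- The norm of `a` is `-(C *ᵥ a) j`, and dominance of `θ' = a + αⱼ + d` at `j` gives `(C *ᵥ a) j ≥
  -- -2`, as `d` contributes nonpositively.
  have haa : a ⬝ᵥ C *ᵥ a = 2 := by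
    have ha0 : a ≠ 0 := fun ha ↦ by
      obtain ⟨i, hi⟩ := hz.isConnectedFinset.nonempty
      have := hapos i hi
      rw [ha] at this
      exact lt_irrefl _ this
    refine le_antisymm ?_ (h.two_le_form ha0)
    rw [hform a haR]
    have h₁ := hθ'.dominant j hjR'
    have h₂ : (C *ᵥ d) j ≤ 0 := h.mulVec_nonpos (fun i ↦ by
      simp only [d]
      split_ifs
      · exact le_rfl
      · exact hθ'.nonneg i) (by simp [d])
    rw [hdecomp, Matrix.mulVec_add, Matrix.mulVec_add, Pi.add_apply, Pi.add_apply] at h₁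
    have h₃ : (C *ᵥ Pi.single j 1) j = 2 := by simp [h.diag]
    omega
  have ha : IsHighestRoot C R a := by
    refine ⟨haa, haR, hapos, fun i hi ↦ ?_⟩
    rw [haC i hi, neg_nonneg]
    refine h.mulVec_nonpos (by simp [Pi.single_nonneg]) (Pi.single_eq_of_ne ?_ _)
    rintro rfl
    exact hjR hi
  rw [ha.unique h hθ, hθ.root] at hθa
  omega

/-- Since `f₁ = f + θ₁` vanishes on `R₂'`, `⟨f, θ₂'⟩ = -⟨θ₁, θ₂'⟩`, which is `0` or `1`. If `0`,
then `R₂' = R₂`. If `1`, then `θ₂' - θ₂` is a positive root pairing to `-1` with `θ₁`, so adding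
`θ₁` gives a positive root. It is orthogonal to `f₂`, so its connected support, which meets `R₁`,
lies in `R₁'`. -/
theorem IsZeroComponent.highestRoot_sub_add_le (h : IsSimplyLacedCartan G C)
    (hz₁ : IsZeroComponent G f R₁) (hz₂ : IsZeroComponent G f R₂) (hne : R₁ ≠ R₂)
    (hθ₁ : IsHighestRoot C R₁ θ₁) (hθ₂ : IsHighestRoot C R₂ θ₂)
    (hf₁ : ∀ j, (f₁ j : ℤ) = f j + (C *ᵥ θ₁) j) (hf₂ : ∀ j, (f₂ j : ℤ) = f j + (C *ᵥ θ₂) j)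
    (hz₁' : IsZeroComponent G f₂ R₁') (hs₁ : R₁ ⊆ R₁')
    (hz₂' : IsZeroComponent G f₁ R₂') (hs₂ : R₂ ⊆ R₂')
    (hθ₁' : IsHighestRoot C R₁' θ₁') (hθ₂' : IsHighestRoot C R₂' θ₂') :
    θ₂' - θ₂ + θ₁ ≤ θ₁' := by
  have hf₁' : (fun i ↦ (f₁ i : ℤ)) = (fun i ↦ (f i : ℤ)) + C *ᵥ θ₁ := funext hf₁
  have hf₂' : (fun i ↦ (f₂ i : ℤ)) = (fun i ↦ (f i : ℤ)) + C *ᵥ θ₂ := funext hf₂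
  have h12 : θ₁ ⬝ᵥ C *ᵥ θ₂ = 0 := h.form_eq_zero_of_not_adj fun i j hi hj ↦
    hz₁.not_adj_of_ne hz₂ hne (hθ₁.mem_of_ne_zero hi) (hθ₂.mem_of_ne_zero hj)
  have hfθ₁ := hz₁.dotProduct_eq_zero hθ₁.eq_zero
  have hfθ₂ := hz₂.dotProduct_eq_zero hθ₂.eq_zero
  have hdot : (fun i ↦ (f i : ℤ)) ⬝ᵥ θ₂' = -(θ₁ ⬝ᵥ C *ᵥ θ₂') := by
    have := hz₂'.dotProduct_eq_zero hθ₂'.eq_zero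
    rw [hf₁', add_dotProduct, dotProduct_comm (C *ᵥ θ₁), h.form_comm] at this
    omega
  have hdotnn := nonneg_dotProduct_of_natCast (f := f) hθ₂'.nonneg
  have hlow : -1 ≤ θ₁ ⬝ᵥ C *ᵥ θ₂' := by
    refine h.neg_one_le_form hθ₁.root hθ₂'.root fun h0 ↦ ?_
    obtain ⟨i, hi⟩ := hz₁.isConnectedFinset.nonempty
    have h₁ := hθ₁.pos i hi
    have h₂ : 0 ≤ θ₂' i := hθ₂'.nonneg i
    have h₃ : θ₁ i + θ₂' i = 0 := congrFun h0 i
    omega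
  by_cases h0 : θ₁ ⬝ᵥ C *ᵥ θ₂' = 0
  · have hz : ∀ i ∈ R₂', f i = 0 := fun i hi ↦ by
      have := (Finset.sum_eq_zero_iff_of_nonneg fun i _ ↦
        mul_nonneg (Int.natCast_nonneg (f i)) (hθ₂'.nonneg i)).1
        (hdot.trans (by rw [h0, neg_zero])) i (Finset.mem_univ i)
      exact_mod_cast (mul_eq_zero.1 this).resolve_right (hθ₂'.pos i hi).ne'
    obtain ⟨i, hi⟩ := hz₂.isConnectedFinset.nonempty
    have hsub := hz₂.subset_of_connected hz₂'.isConnectedFinset hz (hs₂ hi) hi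
    obtain rfl : R₂ = R₂' := hs₂.antisymm hsub
    rw [hθ₂.unique h hθ₂', sub_self, zero_add]
    exact hθ₁'.le h hz₁'.isConnectedFinset hθ₁.root fun i hi ↦
      hθ₁.eq_zero i fun hi' ↦ hi (hs₁ hi')
  have hm1 : θ₁ ⬝ᵥ C *ᵥ θ₂' = -1 := by omega
  have hdot1 : (fun i ↦ (f i : ℤ)) ⬝ᵥ θ₂' = 1 := by omega
  have hpair := hθ₂.form_eq_one_of_dotProduct_eq_one h hz₂ hs₂ hθ₂' hdot1
  have hη : (θ₂' - θ₂) ⬝ᵥ C *ᵥ (θ₂' - θ₂) = 2 := by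
    rw [h.form_sub_self, hθ₂.root, hθ₂'.root, h.form_comm, hpair]
    rfl
  have hηnn : 0 ≤ θ₂' - θ₂ := by
    refine (h.nonneg_or_nonpos hη).resolve_right fun hs ↦ ?_
    have := nonneg_dotProduct_of_natCast (f := f) (neg_nonneg.2 hs)
    rw [neg_sub, dotProduct_sub] at this
    omega
  have hroot : (θ₂' - θ₂ + θ₁) ⬝ᵥ C *ᵥ (θ₂' - θ₂ + θ₁) = 2 := by
    rw [h.form_add_self, hη, hθ₁.root, h.form_comm, Matrix.mulVec_sub, dotProduct_sub]
    omega
  have hf₂η : (fun i ↦ (f₂ i : ℤ)) ⬝ᵥ (θ₂' - θ₂ + θ₁) = 0 := by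
    have h₁ := hθ₂.root
    have h₂ := h.form_comm θ₁ θ₂
    have h₃ := h.form_comm θ₂' θ₂
    rw [hf₂', add_dotProduct, dotProduct_add, dotProduct_sub, dotProduct_comm (C *ᵥ θ₂),
      add_dotProduct, sub_dotProduct]
    omega
  have hnn : 0 ≤ θ₂' - θ₂ + θ₁ := add_nonneg hηnn hθ₁.nonneg
  have hzero : ∀ i, (θ₂' - θ₂ + θ₁) i ≠ 0 → f₂ i = 0 := fun i hi ↦ by
    have := (Finset.sum_eq_zero_iff_of_nonneg fun i _ ↦
      mul_nonneg (Int.natCast_nonneg (f₂ i)) (hnn i)).1 hf₂η i (Finset.mem_univ i)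
    exact_mod_cast (mul_eq_zero.1 this).resolve_right hi
  refine hθ₁'.le h hz₁'.isConnectedFinset hroot fun j hj ↦ ?_
  by_contra hj0
  obtain ⟨i, hi⟩ := hz₁.isConnectedFinset.nonempty
  have hi0 : (θ₂' - θ₂ + θ₁) i ≠ 0 := by
    have h₁ : 0 ≤ (θ₂' - θ₂) i := hηnn i
    have h₂ := hθ₁.pos i hi
    rw [Pi.add_apply]
    omega
  exact hj (h.support_connected hroot (· ∈ R₁')
    (fun k l hkl _ hl hk ↦ hz₁'.mem_of_adj hk hkl (hzero l hl)) hi0 (hs₁ hi) j hj0)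

/-- After a move along another zero component, a zero component is contained in a zero
component. -/
theorem IsZeroComponent.exists_superset (h : IsSimplyLacedCartan G C)
    (hz₁ : IsZeroComponent G f R₁) (hz₂ : IsZeroComponent G f R₂) (hne : R₁ ≠ R₂)
    (hθ₁ : IsHighestRoot C R₁ θ₁) (hf₁ : ∀ j, (f₁ j : ℤ) = f j + (C *ᵥ θ₁) j) :
    ∃ R₂', IsZeroComponent G f₁ R₂' ∧ R₂ ⊆ R₂' := by
  have hzero : ∀ i ∈ R₂, f₁ i = 0 := fun i hi ↦ by
    have := hf₁ i
    rw [hz₂.eq_zero hi, h.mulVec_eq_zero fun k hk ↦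
      hz₁.not_adj_of_ne hz₂ hne (hθ₁.mem_of_ne_zero hk) hi] at this
    exact_mod_cast this
  obtain ⟨i, hi⟩ := hz₂.isConnectedFinset.nonempty
  obtain ⟨R₂', hR, hiR⟩ := exists_isZeroComponent (G := G) (hzero i hi)
  exact ⟨R₂', hR, hR.subset_of_connected hz₂.isConnectedFinset hzero hi hiR⟩

/-- UCF moves commute. -/
theorem ucfMoveAlong_commute (h : IsSimplyLacedCartan G C) (hne : R₁ ≠ R₂)
    (hm₁ : UCFMoveAlong G f R₁ f₁) (hm₂ : UCFMoveAlong G f R₂ f₂) :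
    ∃ R₁' R₂' : Finset X, IsZeroComponent G f₁ R₂' ∧ R₂ ⊆ R₂' ∧
      IsZeroComponent G f₂ R₁' ∧ R₁ ⊆ R₁' ∧
      ∃ f' : X → ℕ, UCFMoveAlong G f₁ R₂' f' ∧ UCFMoveAlong G f₂ R₁' f' := by
  classical
  have hz₁ := hm₁.1
  have hz₂ := hm₂.1
  obtain ⟨θ₁, hθ₁⟩ := h.exists_isHighestRoot hz₁.isConnectedFinset
  obtain ⟨θ₂, hθ₂⟩ := h.exists_isHighestRoot hz₂.isConnectedFinset
  have hf₁ := ((ucfMoveAlong_iff h hθ₁).1 hm₁).2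
  have hf₂ := ((ucfMoveAlong_iff h hθ₂).1 hm₂).2
  obtain ⟨R₂', hz₂', hs₂⟩ := hz₁.exists_superset h hz₂ hne hθ₁ hf₁
  obtain ⟨R₁', hz₁', hs₁⟩ := hz₂.exists_superset h hz₁ hne.symm hθ₂ hf₂
  obtain ⟨θ₁', hθ₁'⟩ := h.exists_isHighestRoot hz₁'.isConnectedFinset
  obtain ⟨θ₂', hθ₂'⟩ := h.exists_isHighestRoot hz₂'.isConnectedFinset
  have hle₁ := hz₁.highestRoot_sub_add_le h hz₂ hne hθ₁ hθ₂ hf₁ hf₂ hz₁' hs₁ hz₂' hs₂ hθ₁' hθ₂'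
  have hle₂ := hz₂.highestRoot_sub_add_le h hz₁ hne.symm hθ₂ hθ₁ hf₂ hf₁ hz₂' hs₂ hz₁' hs₁
    hθ₂' hθ₁'
  -- The two applications of the lemma are opposite inequalities.
  have heq : θ₁ + θ₂' = θ₂ + θ₁' := by
    ext i
    have h₁ := hle₁ i
    have h₂ := hle₂ i
    simp only [Pi.add_apply, Pi.sub_apply] at h₁ h₂ ⊢
    omega
  obtain ⟨f', hf', -⟩ := hz₂'.existsUnique_ucfMoveAlong h
  refine ⟨R₁', R₂', hz₂', hs₂, hz₁', hs₁, f', hf', (ucfMoveAlong_iff h hθ₁').2 ⟨hz₁', fun j ↦ ?_⟩⟩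
  rw [((ucfMoveAlong_iff h hθ₂').1 hf').2 j, hf₁, hf₂, add_assoc, add_assoc, ← Pi.add_apply,
    ← Pi.add_apply, ← Matrix.mulVec_add, ← Matrix.mulVec_add, heq]

end Commute

/-! ### Central-firing from a dominant weight -/

section Orbits

variable {X : Type*} [Fintype X] [DecidableEq X] {G : SimpleGraph X} {C : Matrix X X ℤ}
  {f f' : X → ℕ} {x : X → ℤ}

/-- Adding a root orthogonal to a dominant weight gives, up to the Weyl group, a UCF move. -/
theorem ucfMove_of_wordWeight (h : IsSimplyLacedCartan G C) (L : List X)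
    (hx : x ⬝ᵥ C *ᵥ x = 2) (horth : (fun i ↦ (f i : ℤ)) ⬝ᵥ x = 0)
    (hL : (fun i ↦ (f i : ℤ)) + C *ᵥ x = wordWeight C L fun i ↦ (f' i : ℤ)) : UCFMove G f f' := by
  -- A root has a sign, so all terms of the vanishing sum `∑ f i * x i` have the same sign and are
  -- zero.
  have hzero : ∀ i, x i ≠ 0 → f i = 0 := fun i hi ↦ by
    rcases h.nonneg_or_nonpos hx with hs | hs
    · have := (Finset.sum_eq_zero_iff_of_nonneg fun i _ ↦
        mul_nonneg (Int.natCast_nonneg (f i)) (hs i)).1 horth i (Finset.mem_univ i)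
      exact_mod_cast (mul_eq_zero.1 this).resolve_right hi
    · have := (Finset.sum_eq_zero_iff_of_nonpos fun i _ ↦
        mul_nonpos_of_nonneg_of_nonpos (Int.natCast_nonneg (f i)) (hs i)).1 horth i
          (Finset.mem_univ i)
      exact_mod_cast (mul_eq_zero.1 this).resolve_right hi
  obtain ⟨i, hi⟩ := Function.ne_iff.1 (IsSimplyLacedCartan.ne_zero_of_root hx)
  obtain ⟨R, hz, hiR⟩ := exists_isZeroComponent (G := G) (hzero i hi)
  have hxR : ∀ j, j ∉ R → x j = 0 := fun j hj ↦ by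
    by_contra hj0
    exact hj (h.support_connected hx (· ∈ R)
      (fun k l hkl _ hl hk ↦ hz.mem_of_adj hk hkl (hzero l hl)) hi hiR j hj0)
  obtain ⟨L', hL', hθ, -⟩ := h.exists_word_isHighestRoot hz.isConnectedFinset hx hxR
  refine ⟨R, (ucfMoveAlong_iff h hθ).2 ⟨hz, fun j ↦ ?_⟩⟩
  -- The letters of `L'` lie in `R`, where `f` vanishes, so `L'` fixes `f` while moving `x` to the
  -- highest root.
  have hword : wordWeight C (L' ++ L) (fun i ↦ (f' i : ℤ)) =
      (fun i ↦ (f i : ℤ)) + C *ᵥ wordRoot C L' x := by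
    rw [wordWeight_append, ← hL, wordWeight_add, IsSimplyLacedCartan.wordWeight_mulVec,
      wordWeight_eq_self fun j hj ↦ by simp [hz.eq_zero (hL' j hj)]]
  exact congrFun (h.eq_of_dominant (fun i ↦ Int.natCast_nonneg (f' i))
    (fun j ↦ hz.add_mulVec_nonneg h hθ j) _ hword) j

end Orbits

/-! ### Transfer to root pairings -/

namespace RootPairing.Base

section

variable {ι V N : Type*} [Finite ι] [AddCommGroup V] [Module ℝ V] [AddCommGroup N] [Module ℝ N]
  {P : RootPairing ι ℝ V N} [P.IsRootSystem] [P.IsCrystallographic] (b : P.Base)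

omit [P.IsCrystallographic] [Finite ι] in
theorem ext_of_simple_coroot {v w : V}
    (hvw : ∀ j : b.support, P.toLinearMap v (P.coroot j) = P.toLinearMap w (P.coroot j)) :
    v = w := by
  apply P.toLinearMap.toPerfPair.injective
  refine b.toCoweightBasis.ext fun j ↦ ?_
  simpa using hvw j

/-- The weight with given integral coordinates in the basis of fundamental weights. -/
noncomputable def integralWeight (f : b.support → ℤ) : V := ∑ i, f i • b.fundamentalWeight i

/-- The combination of the simple roots with given integral coefficients. -/
noncomputable def rootCombination (x : b.support → ℤ) : V := ∑ i, x i • P.root i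

/-- The combination of the simple coroots with given integral coefficients. -/
noncomputable def corootCombination (x : b.support → ℤ) : N := ∑ i, x i • P.coroot i

variable {b} {f g x : b.support → ℤ}

omit [P.IsCrystallographic] [Finite ι] in
theorem integralWeight_coroot (f : b.support → ℤ) (j : b.support) :
    P.toLinearMap (b.integralWeight f) (P.coroot j) = f j := by
  classical
  simp only [integralWeight, map_sum, map_zsmul, LinearMap.sum_apply, LinearMap.smul_apply,
    b.fundamentalWeight_coroot]
  simp

omit [P.IsCrystallographic] [Finite ι] in
theorem integralWeight_corootCombination (f x : b.support → ℤ) :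
    P.toLinearMap (b.integralWeight f) (b.corootCombination x) = ((f ⬝ᵥ x : ℤ) : ℝ) := by
  simp only [corootCombination, map_sum, map_zsmul, integralWeight_coroot, dotProduct]
  simp [mul_comm]

omit [P.IsCrystallographic] [Finite ι] in
theorem weightOf_eq (f : b.support → ℕ) : b.weightOf f = b.integralWeight fun i ↦ (f i : ℤ) := by
  simp [weightOf, integralWeight]

omit [P.IsCrystallographic] [Finite ι] in
theorem integralWeight_add (f g : b.support → ℤ) :
    b.integralWeight (f + g) = b.integralWeight f + b.integralWeight g := by
  simp [integralWeight, add_smul, Finset.sum_add_distrib]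

omit [P.IsCrystallographic] [Finite ι] in
theorem integralWeight_injective : Function.Injective b.integralWeight := fun f g hfg ↦ by
  ext j
  have := integralWeight_coroot f j
  rw [hfg, integralWeight_coroot] at this
  exact_mod_cast this.symm

theorem isSimplyLacedCartan (hsl : b.cartanMatrix.IsSimplyLaced) :
    IsSimplyLacedCartan b.dynkinGraph b.cartanMatrix where
  diag := b.cartanMatrix_apply_same
  adj i j hij := by
    obtain ⟨hne, h⟩ := (SimpleGraph.fromRel_adj _ _ _).1 hij
    refine (hsl hne).resolve_left fun h0 ↦ ?_
    exact h.elim (fun h ↦ h h0) fun h ↦ h (b.cartanMatrix_apply_eq_zero_iff_symm.1 h0)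
  not_adj i j hne h := by
    by_contra h0
    exact h ((SimpleGraph.fromRel_adj _ _ _).2 ⟨hne, .inl h0⟩)
  pos x hx := by
    classical
    have := Fintype.ofFinite ι
    let B := P.RootForm
    have hpos : ∀ i : b.support, 0 < B (P.root i) (P.root i) := fun i ↦
      P.rootForm_pos_of_ne_zero (by simp) (P.ne_zero i)
    -- Root lengths may differ between irreducible components. Rescaling each simple root to norm
    -- `2` makes the Gram matrix equal to the Cartan matrix, because adjacent simple roots have
    -- equal length.
    let s : b.support → ℝ := fun i ↦ √(2 / B (P.root i) (P.root i))
    have hs : ∀ i, 0 < s i := fun i ↦ Real.sqrt_pos.2 (div_pos two_pos (hpos i))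
    let v : V := ∑ i : b.support, ((x i : ℝ) * s i) • P.root i
    have hv : v ≠ 0 := fun hv ↦ hx <| by
      ext i
      have := Fintype.linearIndependent_iff.1 b.linearIndepOn_root _ hv i
      simpa [(hs i).ne'] using this
    have hB : ∀ i j : b.support, s i * s j * B (P.root i) (P.root j) = b.cartanMatrix i j := by
      intro i j
      have h₁ : 2 * B (P.root i) (P.root j) = P.pairing i j * B (P.root j) (P.root j) :=
        P.toInvariantForm.two_mul_apply_root_root i j
      have h₁' : 2 * B (P.root j) (P.root i) = P.pairing j i * B (P.root i) (P.root i) :=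
        P.toInvariantForm.two_mul_apply_root_root j i
      have hc : (b.cartanMatrix i j : ℝ) = P.pairing i j :=
        b.algebraMap_cartanMatrixIn_apply ℤ i j
      have hc' : (b.cartanMatrix j i : ℝ) = P.pairing j i :=
        b.algebraMap_cartanMatrixIn_apply ℤ j i
      have hcomm : B (P.root i) (P.root j) = B (P.root j) (P.root i) :=
        P.rootForm_symmetric.eq _ _
      have key : b.cartanMatrix i j = 0 ∨ B (P.root i) (P.root i) = B (P.root j) (P.root j) := by
        rcases eq_or_ne i j with rfl | hij
        · exact .inr rfl
        by_cases h0 : b.cartanMatrix i j = 0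
        · exact .inl h0
        have e₁ := (hsl hij).resolve_left h0
        have e₂ := (hsl hij.symm).resolve_left fun h ↦ h0 (b.cartanMatrix_apply_eq_zero_iff_symm.1 h)
        rw [← hc, e₁] at h₁
        rw [← hc', e₂] at h₁'
        push_cast at h₁ h₁'
        exact .inr (by linarith)
      rcases key with h0 | he
      · rw [h0] at hc ⊢
        rw [← hc] at h₁
        have : B (P.root i) (P.root j) = 0 := by
          push_cast at h₁
          linarith
        simp [this]
      · have hss : s i * s j = 2 / B (P.root j) (P.root j) := by
          simp only [s, he]
          exact Real.mul_self_sqrt (div_pos two_pos (hpos j)).le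
        have := (hpos j).ne'
        rw [hss, hc]
        field_simp
        linarith
    have hvv : B v v = ((x ⬝ᵥ b.cartanMatrix *ᵥ x : ℤ) : ℝ) := by
      simp only [v, map_sum, map_smul, LinearMap.sum_apply, LinearMap.smul_apply, dotProduct,
        Matrix.mulVec, Int.cast_sum, Int.cast_mul, Finset.mul_sum, smul_eq_mul]
      rw [Finset.sum_comm]
      refine Finset.sum_congr rfl fun i _ ↦ Finset.sum_congr rfl fun j _ ↦ ?_
      rw [← hB]
      ring
    have : 0 < B v v := P.rootForm_pos_of_ne_zero (by simp) hv
    rw [hvv] at this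
    exact_mod_cast this

variable (hsl : b.cartanMatrix.IsSimplyLaced)
include hsl

theorem rootCombination_eq (x : b.support → ℤ) :
    b.rootCombination x = b.integralWeight (b.cartanMatrix *ᵥ x) := by
  refine b.ext_of_simple_coroot fun j ↦ ?_
  rw [integralWeight_coroot]
  simp only [rootCombination, map_sum, map_zsmul, LinearMap.sum_apply, LinearMap.smul_apply,
    Matrix.mulVec, dotProduct, Int.cast_sum]
  refine Finset.sum_congr rfl fun i _ ↦ ?_
  have : (b.cartanMatrix i j : ℝ) = P.pairing i j := b.algebraMap_cartanMatrixIn_apply ℤ i j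
  rw [(isSimplyLacedCartan hsl).apply_comm, Int.cast_mul, this, P.root_coroot_eq_pairing]
  simp [mul_comm]

theorem rootCombination_coroot (x : b.support → ℤ) (j : b.support) :
    P.toLinearMap (b.rootCombination x) (P.coroot j) = ((b.cartanMatrix *ᵥ x) j : ℤ) := by
  rw [rootCombination_eq hsl, integralWeight_coroot]

omit [Finite ι] [P.IsRootSystem] hsl in
theorem root_corootCombination (x : b.support → ℤ) (j : b.support) :
    P.toLinearMap (P.root j) (b.corootCombination x) = ((b.cartanMatrix *ᵥ x) j : ℤ) := by
  simp only [corootCombination, map_sum, map_zsmul, Matrix.mulVec, dotProduct, Int.cast_sum]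
  refine Finset.sum_congr rfl fun i _ ↦ ?_
  have : (b.cartanMatrix j i : ℝ) = P.pairing j i := b.algebraMap_cartanMatrixIn_apply ℤ j i
  rw [Int.cast_mul, this, P.root_coroot_eq_pairing]
  simp [mul_comm]

variable [DecidableEq b.support]

omit [P.IsCrystallographic] [P.IsRootSystem] [Finite ι] hsl in
theorem rootCombination_sub_single (x : b.support → ℤ) (j : b.support) (c : ℤ) :
    b.rootCombination (x - Pi.single j c) = b.rootCombination x - c • P.root j := by
  simp [rootCombination, sub_smul, Finset.sum_sub_distrib, Pi.single_apply, ite_smul]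

omit [P.IsCrystallographic] [P.IsRootSystem] [Finite ι] hsl in
theorem corootCombination_sub_single (x : b.support → ℤ) (j : b.support) (c : ℤ) :
    b.corootCombination (x - Pi.single j c) = b.corootCombination x - c • P.coroot j := by
  simp [corootCombination, sub_smul, Finset.sum_sub_distrib, Pi.single_apply, ite_smul]

theorem root_coroot_reflectionPerm {i : ι} (hx : P.root i = b.rootCombination x)
    (hx' : P.coroot i = b.corootCombination x) (j : b.support) :
    P.root (P.reflectionPerm j i) =
        b.rootCombination (simpleReflRoot b.cartanMatrix j x) ∧
      P.coroot (P.reflectionPerm j i) =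
        b.corootCombination (simpleReflRoot b.cartanMatrix j x) := by
  constructor
  · rw [P.root_reflectionPerm, P.reflection_apply, simpleReflRoot, rootCombination_sub_single,
      hx]
    congr 1
    rw [← Int.cast_smul_eq_zsmul ℝ, ← rootCombination_coroot hsl]
    rfl
  · rw [P.coroot_reflectionPerm, P.coreflection_apply, simpleReflRoot,
      corootCombination_sub_single, hx']
    congr 1
    rw [← Int.cast_smul_eq_zsmul ℝ, ← root_corootCombination]

/-- A nonnegative norm `2` vector pairs positively with some simple root. Unless it equals that
root, reflecting keeps it nonnegative and lowers its coefficient sum, so it descends to a simple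
root. Nonpositive vectors follow by negation. -/
theorem exists_root_eq_rootCombination (hx : x ⬝ᵥ b.cartanMatrix *ᵥ x = 2) :
    ∃ i, P.root i = b.rootCombination x ∧ P.coroot i = b.corootCombination x := by
  have h := isSimplyLacedCartan hsl
  have key : ∀ x : b.support → ℤ, x ⬝ᵥ b.cartanMatrix *ᵥ x = 2 → 0 ≤ x →
      ∃ i, P.root i = b.rootCombination x ∧ P.coroot i = b.corootCombination x := by
    intro x hx hnn
    induction hn : (∑ i, x i).toNat using Nat.strong_induction_on generalizing x with
    | _ n ih =>
      obtain ⟨j, hj, hCj⟩ : ∃ j, 0 < x j ∧ 0 < (b.cartanMatrix *ᵥ x) j := by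
        by_contra! hc
        have : x ⬝ᵥ b.cartanMatrix *ᵥ x ≤ 0 := Finset.sum_nonpos fun j _ ↦ by
          rcases (hnn j).eq_or_lt with h0 | h0
          · simp [← h0]
          · exact mul_nonpos_of_nonneg_of_nonpos h0.le (hc j h0)
        omega
      by_cases hne : x = Pi.single j 1
      · refine ⟨j, ?_, ?_⟩
        · simp [hne, rootCombination, Pi.single_apply, ite_smul]
        · simp [hne, corootCombination, Pi.single_apply, ite_smul]
      · have hnn' := h.simpleReflRoot_nonneg hx hnn hne
        have hsum : ∑ i, simpleReflRoot b.cartanMatrix j x i =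
            ∑ i, x i - (b.cartanMatrix *ᵥ x) j := by
          simp [simpleReflRoot]
        have hsum' := Finset.sum_nonneg fun i (_ : i ∈ Finset.univ) ↦ hnn' i
        obtain ⟨i, hi, hi'⟩ := ih _ (by omega) _ (h.simpleReflRoot_root hx) hnn' rfl
        have := root_coroot_reflectionPerm hsl hi hi' j
        refine ⟨P.reflectionPerm j i, ?_⟩
        have hinv : simpleReflRoot b.cartanMatrix j (simpleReflRoot b.cartanMatrix j x) = x := by
          rw [simpleReflRoot, simpleReflRoot, Matrix.mulVec_sub, Pi.sub_apply,
            Matrix.mulVec_single]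
          ext k
          rcases eq_or_ne k j with rfl | hk
          · simp
            ring
          · simp [hk]
        rwa [hinv] at this
  rcases h.nonneg_or_nonpos hx with hs | hs
  · exact key x hx hs
  · obtain ⟨i, hi, hi'⟩ := key (-x) (by simpa [Matrix.mulVec_neg] using hx) (neg_nonneg.2 hs)
    refine ⟨P.reflectionPerm i i, ?_, ?_⟩
    · rw [P.root_reflectionPerm, P.reflection_apply_self, hi]
      simp [rootCombination]
    · rw [P.coroot_reflectionPerm, P.coreflection_apply_self, hi']
      simp [corootCombination]

variable [P.IsReduced]

theorem exists_coordinates (i : ι) : ∃ x : b.support → ℤ, x ⬝ᵥ b.cartanMatrix *ᵥ x = 2 ∧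
    P.root i = b.rootCombination x ∧ P.coroot i = b.corootCombination x := by
  have h := isSimplyLacedCartan hsl
  refine b.induction_reflect i (p := fun i ↦ ∃ x : b.support → ℤ,
    x ⬝ᵥ b.cartanMatrix *ᵥ x = 2 ∧ P.root i = b.rootCombination x ∧
      P.coroot i = b.corootCombination x) (fun i ⟨x, hx, hi, hi'⟩ ↦ ⟨-x, ?_, ?_, ?_⟩)
    (fun i hi ↦ ⟨Pi.single ⟨i, hi⟩ 1, h.single_root _, ?_, ?_⟩)
    fun i j ⟨x, hx, hi, hi'⟩ hj ↦ ⟨simpleReflRoot b.cartanMatrix ⟨j, hj⟩ x,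
      h.simpleReflRoot_root hx, root_coroot_reflectionPerm hsl hi hi' ⟨j, hj⟩⟩
  · simpa [Matrix.mulVec_neg] using hx
  · rw [P.root_reflectionPerm, P.reflection_apply_self, hi]
    simp [rootCombination]
  · rw [P.coroot_reflectionPerm, P.coreflection_apply_self, hi']
    simp [corootCombination]
  · simp [rootCombination, Pi.single_apply, ite_smul]
  · simp [corootCombination, Pi.single_apply, ite_smul]

omit [DecidableEq b.support] in
-- Every root is obtained from simple roots by negation and simple reflections, and the reflection
-- in `sⱼ α` is the conjugate of that in `α` by `sⱼ`.
theorem exists_word_of_reflection (i : ι) : ∃ L : List b.support, ∀ f : b.support → ℤ,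
    P.reflection i (b.integralWeight f) = b.integralWeight (wordWeight b.cartanMatrix L f) := by
  classical
  have simple : ∀ (j : b.support) (f : b.support → ℤ), P.reflection j (b.integralWeight f) =
      b.integralWeight (simpleReflWeight b.cartanMatrix j f) := fun j f ↦ by
    refine b.ext_of_simple_coroot fun k ↦ ?_
    have hc : (b.cartanMatrix j k : ℝ) = P.pairing j k := b.algebraMap_cartanMatrixIn_apply ℤ j k
    rw [P.reflection_apply, map_sub, map_smul, LinearMap.sub_apply, LinearMap.smul_apply,
      integralWeight_coroot, integralWeight_coroot, P.root_coroot_eq_pairing, ← hc,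
      (isSimplyLacedCartan hsl).apply_comm]
    have : P.coroot' j (b.integralWeight f) = f j := integralWeight_coroot f j
    rw [this]
    simp [simpleReflWeight]
  refine b.induction_reflect i (p := fun i ↦ ∃ L : List b.support, ∀ f : b.support → ℤ,
    P.reflection i (b.integralWeight f) = b.integralWeight (wordWeight b.cartanMatrix L f))
    (fun i ⟨L, hL⟩ ↦ ⟨L, fun f ↦ ?_⟩) (fun i hi ↦ ⟨[⟨i, hi⟩], fun f ↦ ?_⟩)
    fun i j ⟨L, hL⟩ hj ↦ ⟨[⟨j, hj⟩] ++ L ++ [⟨j, hj⟩], fun f ↦ ?_⟩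
  · rw [P.reflection_reflectionPerm]
    simp [← hL]
  · exact simple ⟨i, hi⟩ f
  · have := simple ⟨j, hj⟩
    dsimp only at this
    rw [P.reflection_reflectionPerm]
    simp [wordWeight_append, this, hL]

omit [DecidableEq b.support] in
theorem exists_word_of_weylGroup (w : P.weylGroup) : ∃ L : List b.support, ∀ f : b.support → ℤ,
    w • b.integralWeight f = b.integralWeight (wordWeight b.cartanMatrix L f) := by
  obtain ⟨w, hw⟩ := w
  induction hw using weylGroup.induction with
  | mem i =>
    obtain ⟨L, hL⟩ := exists_word_of_reflection hsl i
    refine ⟨L, fun f ↦ ?_⟩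
    rw [← hL]
    rfl
  | one => exact ⟨[], fun f ↦ one_smul _ _⟩
  | mul w₁ w₂ h₁ h₂ ih₁ ih₂ =>
    obtain ⟨L₁, hL₁⟩ := ih₁
    obtain ⟨L₂, hL₂⟩ := ih₂
    refine ⟨L₁ ++ L₂, fun f ↦ ?_⟩
    rw [wordWeight_append, ← hL₁, ← hL₂, ← mul_smul]
    rfl

omit [DecidableEq b.support] [P.IsReduced] [P.IsCrystallographic] [P.IsRootSystem] [Finite ι] hsl in
theorem isPos_of_nonneg {i : ι} (hx : 0 ≤ x) (hi : P.root i = b.rootCombination x) :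
    b.IsPos i := by
  classical
  let g : ι → ℤ := fun k ↦ if hk : k ∈ b.support then x ⟨k, hk⟩ else 0
  have hg : ∀ k : b.support, g k = x k := fun k ↦ by simp [g]
  have hsum : P.root i = ∑ j ∈ b.support, g j • P.root j := by
    rw [hi, rootCombination, ← Finset.sum_coe_sort b.support fun j ↦ g j • P.root j]
    simp only [hg]
  rw [isPos_iff', height_eq_sum hsum, ← Finset.sum_coe_sort]
  exact Finset.sum_nonneg fun k _ ↦ (hx k).trans_eq (hg k).symm

omit [DecidableEq b.support] in
theorem ucfMove_iff (f f' : b.support → ℕ) : UCFMove b.dynkinGraph f f' ↔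
    b.UnlabeledCentralFires (MulAction.orbit P.weylGroup (b.weightOf f))
      (MulAction.orbit P.weylGroup (b.weightOf f')) := by
  classical
  have h := isSimplyLacedCartan hsl
  constructor
  · rintro ⟨R, hR⟩
    obtain ⟨θ, hθ⟩ := h.exists_isHighestRoot hR.1.isConnectedFinset
    have hf := ((ucfMoveAlong_iff h hθ).1 hR).2
    obtain ⟨i, hi, hi'⟩ := exists_root_eq_rootCombination hsl hθ.root
    refine ⟨_, MulAction.mem_orbit_self _, _, MulAction.mem_orbit_self _, fun k ↦ ?_, i,
      isPos_of_nonneg hθ.nonneg hi, ?_, ?_⟩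
    · obtain ⟨x, -, -, hx⟩ := exists_coordinates hsl k
      exact ⟨_, by rw [weightOf_eq, hx, integralWeight_corootCombination]⟩
    · rw [weightOf_eq, hi', integralWeight_corootCombination, hR.1.dotProduct_eq_zero hθ.eq_zero,
        Int.cast_zero]
    · rw [weightOf_eq, weightOf_eq, hi, rootCombination_eq hsl, ← integralWeight_add]
      exact congrArg _ (funext hf)
  · rintro ⟨_, ⟨w, rfl⟩, _, ⟨w', rfl⟩, -, i, -, h0, hadd⟩
    obtain ⟨x, hx, hi, hi'⟩ := exists_coordinates hsl i
    obtain ⟨L, hL⟩ := exists_word_of_weylGroup hsl w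
    obtain ⟨L', hL'⟩ := exists_word_of_weylGroup hsl w'
    dsimp only at h0 hadd
    rw [weightOf_eq, hL, hi', integralWeight_corootCombination, Int.cast_eq_zero] at h0
    rw [weightOf_eq, weightOf_eq, hL, hL', hi, rootCombination_eq hsl, ← integralWeight_add] at hadd
    replace hadd := integralWeight_injective hadd
    -- Translating by the inverse of `w` makes the base point the dominant weight of `f`. The
    -- translated root may be negative, which is harmless: it can still be moved to the highest root
    -- of its zero component.
    refine ucfMove_of_wordWeight h (L.reverse ++ L') (x := wordRoot b.cartanMatrix L.reverse x)
      (h.wordRoot_form.trans hx) ?_ ?_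
    · rw [← h0, ← h.wordWeight_dot (L := L.reverse) (x := x), h.wordWeight_reverse]
    · rw [wordWeight_append, hadd, wordWeight_add, h.wordWeight_reverse,
        IsSimplyLacedCartan.wordWeight_mulVec]

end

end RootPairing.Base

theorem mainTheorem2 {ι V N : Type*} [Finite ι] [AddCommGroup V] [Module ℝ V] [AddCommGroup N]
    [Module ℝ N] (P : RootPairing ι ℝ V N) [P.IsRootSystem] [P.IsCrystallographic] [P.IsReduced]
    (b : P.Base) (hsl : b.cartanMatrix.IsSimplyLaced) :
    -- UCF moves are well defined: along each zero component there is exactly one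
    (∀ (f : b.support → ℕ) (R : Finset b.support), IsZeroComponent b.dynkinGraph f R →
      ∃! f' : b.support → ℕ, UCFMoveAlong b.dynkinGraph f R f') ∧
    -- UCF moves are exactly the unlabeled central-firing moves
    (∀ f f' : b.support → ℕ, UCFMove b.dynkinGraph f f' ↔
      b.UnlabeledCentralFires (MulAction.orbit P.weylGroup (b.weightOf f))
        (MulAction.orbit P.weylGroup (b.weightOf f'))) ∧
    -- UCF moves along two different zero components commute
    (∀ (f f₁ f₂ : b.support → ℕ) (R₁ R₂ : Finset b.support), R₁ ≠ R₂ →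
      UCFMoveAlong b.dynkinGraph f R₁ f₁ → UCFMoveAlong b.dynkinGraph f R₂ f₂ →
      ∃ R₁' R₂' : Finset b.support,
        IsZeroComponent b.dynkinGraph f₁ R₂' ∧ R₂ ⊆ R₂' ∧
        IsZeroComponent b.dynkinGraph f₂ R₁' ∧ R₁ ⊆ R₁' ∧
        ∃ f'' : b.support → ℕ,
          UCFMoveAlong b.dynkinGraph f₁ R₂' f'' ∧ UCFMoveAlong b.dynkinGraph f₂ R₁' f'') := by
  have h := RootPairing.Base.isSimplyLacedCartan hsl
  exact ⟨fun _ _ hz ↦ hz.existsUnique_ucfMoveAlong h, RootPairing.Base.ucfMove_iff hsl,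
    fun _ _ _ _ _ hne h₁ h₂ ↦ ucfMoveAlong_commute h hne h₁ h₂⟩
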